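/- **Theorem.** Repeated Coverability for Wait-Only protocols is PSpace-hard (under polynomial-time many-one reductions). Here a *protocol* is a tuple $(Q,\Sigma,q_{in},T)$ with a finite set $Q$ of states, a finite set $\Sigma$ of messages, an initial state $q_{in}\in Q$ and a set of transitions $T\subseteq Q\times(\{!!a: a\in\Sigma\}\cup\{?a: a\in\Sigma\})\times Q$. It is *Wait-Only* if no state has both an outgoing broadcast transition $(q,!!a,q')$ and an outgoing reception transition $(q,?a,q')$; as usual, it is also required that $q_{in}$ has no outgoing reception transition and that there is no broadcast self-loop $(q,!!a,q)\in T$. For $n>0$, a configuration of $n$ processes is a vector $C\in Q^n$. For a transition $t=(q,!!a,q')\in T$ and $e\in\{1,\dots,n\}$, we write $C\xrightarrow{e,t}C'$ if $C(e)=q$, $C'(e)=q'$ and for every $e'\neq e$ either $(C(e'),?a,C'(e'))\in T$, or $C'(e')=C(e')$ and there is no $p\in Q$ with $(C(e'),?a,p)\in T$. An infinite execution is a sequence $\rho_0,\rho_1,\dots$ of configurations of the same number $n>0$ of processes such that $\rho_0(e)=q_{in}$ for all $e$ and, for every $i$, $\rho_i\xrightarrow{e,t}\rho_{i+1}$ for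 some $e$ and some broadcast transition $t\in T$. *Repeated Coverability* for Wait-Only protocols is the following decision problem. Input: a Wait-Only protocol as above (given explicitly, by listing its transitions) and one of its broadcast transitions $t$. Question: are there a number $n>0$, an infinite execution $\rho$ with $n$ processes and a process $e$ such that for every $i\in\mathbb N$ there is $j>i$ with $\rho_j\xrightarrow{e,t}\rho_{j+1}$? Thus, for every finite alphabet $A$ and every language $L\subseteq A^*$ that is decided by a deterministic Turing machine in polynomial space, there is a function $f$, computable in polynomial time, that maps each word $w\in A^*$ to an input of Repeated Coverability for Wait-Only protocols such that $w\in L$ if and only if the answer for $f(w)$ is yes. This holds even when the states and messages in the inputs are written as numbers in unary. -/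

import Mathlib

/-! ### Broadcast protocols and their semantics -/

/-- Actions over a message alphabet: broadcasting `a` (written `!!a`) or receiving `a`
(written `?a`). -/
inductive Op (S : Type) : Type
  | bcast (a : S) : Op S
  | recv (a : S) : Op S

/-- A protocol with set of states `Q` and message alphabet `S`: an initial state and a set of
transitions. (In the decision problem below, `Q` and `S` are finite.) -/
structure Protocol (Q S : Type) where
  init : Q
  trans : Set (Q × Op S × Q)

namespace Protocol

variable {Q S : Type}

/-- `P.R q` is the set of messages that can be received in state `q`. -/
def R (P : Protocol Q S) (q : Q) : Set S :=
  {a | ∃ q', (q, Op.recv a, q') ∈ P.trans}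

/-- No state has both an outgoing reception and an outgoing broadcast. -/
def WaitOnly (P : Protocol Q S) : Prop :=
  ∀ q : Q, (∀ a q', (q, Op.recv a, q') ∉ P.trans) ∨ (∀ a q', (q, Op.bcast a, q') ∉ P.trans)

/-- A waiting state is a state with an outgoing reception. -/
def IsWaiting (P : Protocol Q S) (q : Q) : Prop :=
  ∃ a q', (q, Op.recv a, q') ∈ P.trans

/-- An action state is a state that is not waiting. -/
def IsAction (P : Protocol Q S) (q : Q) : Prop :=
  ¬ P.IsWaiting q

/-- There is no transition of the form `(q, !!a, q)`. -/
def NoBroadcastSelfLoop (P : Protocol Q S) : Prop :=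
  ∀ q a, (q, Op.bcast a, q) ∉ P.trans

/-- `P.StepBy e q a q' C C'`: from the configuration `C` of `n` processes, the process `e` takes
the broadcast transition `(q, !!a, q')`, every other process able to receive `a` takes some
reception of `a`, all remaining processes stay put, and the resulting configuration is `C'`. -/
def StepBy (P : Protocol Q S) {n : ℕ} (e : Fin n) (q : Q) (a : S) (q' : Q)
    (C C' : Fin n → Q) : Prop :=
  (q, Op.bcast a, q') ∈ P.trans ∧ C e = q ∧ C' e = q' ∧
    ∀ e' : Fin n, e' ≠ e →
      (C e', Op.recv a, C' e') ∈ P.trans ∨ (a ∉ P.R (C e') ∧ C' e' = C e')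

/-- One step of the broadcast network. -/
def Step (P : Protocol Q S) {n : ℕ} (C C' : Fin n → Q) : Prop :=
  ∃ (e : Fin n) (q : Q) (a : S) (q' : Q), P.StepBy e q a q' C C'

/-- An infinite execution with `n` processes, starting in the initial configuration. -/
def IsInfExecution (P : Protocol Q S) {n : ℕ} (ρ : ℕ → Fin n → Q) : Prop :=
  (∀ e, ρ 0 e = P.init) ∧ ∀ i, P.Step (ρ i) (ρ (i + 1))

/-- For some number `n > 0` of processes there is an infinite execution in which one and the same
process `e` takes the transition `(q, !!a, q')` infinitely often. -/
def RepeatedlyCoverable (P : Protocol Q S) (q : Q) (a : S) (q' : Q) : Prop :=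
  ∃ n : ℕ, 0 < n ∧ ∃ ρ : ℕ → Fin n → Q, P.IsInfExecution ρ ∧
    ∃ e : Fin n, ∀ i : ℕ, ∃ j : ℕ, i < j ∧ P.StepBy e q a q' (ρ j) (ρ (j + 1))

end Protocol

/-! ### Instances of Repeated Coverability and their encoding as words -/

/-- An explicitly given finite protocol, with states `0, …, numStates - 1`, messages
`0, …, numMsgs - 1` and an enumeration of its transitions, together with one of its broadcast
transitions `(src, !!msg, dst)`. -/
structure RCInstance where
  numStates : ℕ
  numMsgs : ℕ
  init : Fin numStates
  trans : List (Fin numStates × Op (Fin numMsgs) × Fin numStates)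
  src : Fin numStates
  msg : Fin numMsgs
  dst : Fin numStates
  mem_trans : (src, Op.bcast msg, dst) ∈ trans

namespace RCInstance

/-- The protocol presented by an instance. -/
def protocol (I : RCInstance) : Protocol (Fin I.numStates) (Fin I.numMsgs) where
  init := I.init
  trans := {t | t ∈ I.trans}

/-- The finite alphabet in which instances are written. -/
inductive Sym : Type
  | tick
  | comma
  | bang
  | quest
  deriving DecidableEq

instance : Fintype Sym where
  elems := {Sym.tick, Sym.comma, Sym.bang, Sym.quest}
  complete x := by cases x <;> simp

/-- A number, in unary, followed by a separator. -/
def encodeNat (n : ℕ) : List Sym :=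
  List.replicate n Sym.tick ++ [Sym.comma]

/-- A transition `(q, !!a, q')` or `(q, ?a, q')`. -/
def encodeTrans {k m : ℕ} : Fin k × Op (Fin m) × Fin k → List Sym
  | (q, Op.bcast a, q') => encodeNat q ++ Sym.bang :: (encodeNat a ++ encodeNat q')
  | (q, Op.recv a, q') => encodeNat q ++ Sym.quest :: (encodeNat a ++ encodeNat q')

/-- The word presenting an instance. Its length is polynomially bounded in the number of states,
messages and listed transitions. -/
def encode (I : RCInstance) : List Sym :=
  encodeNat I.numStates ++ (encodeNat I.numMsgs ++ (encodeNat I.init ++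
    (encodeNat I.src ++ (encodeNat I.msg ++ (encodeNat I.dst ++ I.trans.flatMap encodeTrans)))))

theorem encodeNat_append_inj {n n' : ℕ} {l l' : List Sym}
    (h : encodeNat n ++ l = encodeNat n' ++ l') : n = n' ∧ l = l' := by
  induction n generalizing n' with
  | zero =>
    cases n' with
    | zero => exact ⟨rfl, by simpa [encodeNat] using h⟩
    | succ n' => simp [encodeNat, List.replicate_succ] at h
  | succ n ih =>
    cases n' with
    | zero => simp [encodeNat, List.replicate_succ] at h
    | succ n' =>
      have h2 : encodeNat n ++ l = encodeNat n' ++ l' := by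
        simpa [encodeNat, List.replicate_succ] using h
      obtain ⟨h3, h4⟩ := ih h2
      exact ⟨by rw [h3], h4⟩

theorem encodeTrans_append_inj {k m : ℕ} {t t' : Fin k × Op (Fin m) × Fin k} {l l' : List Sym}
    (h : encodeTrans t ++ l = encodeTrans t' ++ l') : t = t' ∧ l = l' := by
  obtain ⟨q, o, p⟩ := t
  obtain ⟨q', o', p'⟩ := t'
  cases o <;> cases o' <;>
    simp only [encodeTrans, List.append_assoc, List.cons_append] at h <;>
    obtain ⟨h1, h⟩ := encodeNat_append_inj h <;>
    simp only [List.cons.injEq, reduceCtorEq, false_and, true_and] at h <;>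
    obtain ⟨h2, h⟩ := encodeNat_append_inj h <;>
    obtain ⟨h3, h⟩ := encodeNat_append_inj h <;>
    simp [Fin.ext_iff, h1, h2, h3, h]

theorem encodeTrans_ne_nil {k m : ℕ} (t : Fin k × Op (Fin m) × Fin k) : encodeTrans t ≠ [] := by
  obtain ⟨q, o, p⟩ := t
  cases o <;> simp [encodeTrans]

theorem flatMap_encodeTrans_inj {k m : ℕ} (T T' : List (Fin k × Op (Fin m) × Fin k))
    (h : T.flatMap encodeTrans = T'.flatMap encodeTrans) : T = T' := by
  induction T generalizing T' with
  | nil =>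
    cases T' with
    | nil => rfl
    | cons t' T' =>
      rw [List.flatMap_nil, List.flatMap_cons] at h
      exact absurd (List.append_eq_nil_iff.1 h.symm).1 (encodeTrans_ne_nil t')
  | cons t T ih =>
    cases T' with
    | nil =>
      rw [List.flatMap_nil, List.flatMap_cons] at h
      exact absurd (List.append_eq_nil_iff.1 h).1 (encodeTrans_ne_nil t)
    | cons t' T' =>
      rw [List.flatMap_cons, List.flatMap_cons] at h
      obtain ⟨h1, h2⟩ := encodeTrans_append_inj h
      rw [h1, ih T' h2]

theorem encode_injective : Function.Injective encode := by
  rintro ⟨k, m, i, T, s, a, d, hT⟩ ⟨k', m', i', T', s', a', d', hT'⟩ h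
  simp only [encode] at h
  obtain ⟨h1, h⟩ := encodeNat_append_inj h
  obtain ⟨h2, h⟩ := encodeNat_append_inj h
  subst h1 h2
  obtain ⟨h3, h⟩ := encodeNat_append_inj h
  obtain ⟨h4, h⟩ := encodeNat_append_inj h
  obtain ⟨h5, h⟩ := encodeNat_append_inj h
  obtain ⟨h6, hT⟩ := encodeNat_append_inj h
  have h7 := flatMap_encodeTrans_inj _ _ hT
  obtain rfl := Fin.ext h3
  obtain rfl := Fin.ext h4
  obtain rfl := Fin.ext h5
  obtain rfl := Fin.ext h6
  subst h7
  rfl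

end RCInstance

/-- The inputs of Repeated Coverability for Wait-Only protocols: the protocol is Wait-Only, its
initial state is an action state, and it has no broadcast self-loops. -/
def WaitOnlyInstance : Type :=
  {I : RCInstance //
    I.protocol.WaitOnly ∧ I.protocol.IsAction I.protocol.init ∧ I.protocol.NoBroadcastSelfLoop}

namespace WaitOnlyInstance

/-- The decision problem Repeated Coverability (for Wait-Only protocols). -/
def RepeatedCoverability (I : WaitOnlyInstance) : Prop :=
  I.1.protocol.RepeatedlyCoverable I.1.src I.1.msg I.1.dst

open Classical in
/-- The encoding of the inputs as words, namely `RCInstance.encode`. -/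
noncomputable def encoding : Computability.Encoding WaitOnlyInstance RCInstance.Sym where
  encode I := I.1.encode
  decode w := if h : ∃ I : WaitOnlyInstance, I.1.encode = w then some h.choose else none
  decode_encode I := by
    have h : ∃ J : WaitOnlyInstance, J.1.encode = I.1.encode := ⟨I, rfl⟩
    rw [dif_pos h]
    exact congrArg some (Subtype.ext (RCInstance.encode_injective h.choose_spec))

end WaitOnlyInstance

/-! ### Polynomial space and hardness -/

instance (tm : Turing.FinTM2) : Fintype tm.K :=
  tm.kFin

open Classical in
/-- `L` is decided by a deterministic multi-stack Turing machine that halts on every word `w`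
with answer `true` or `false`, according to whether `w ∈ L`, and during whose computation on `w`
the total number of symbols on all the stacks never exceeds a fixed polynomial in the length of
`w`. -/
def InPSpace {α : Type} (L : Language α) : Prop :=
  ∃ (M : Turing.TM2Computable (id : List α → List α) Computability.encodeBool
      (fun w => decide (w ∈ L))) (s : Polynomial ℕ),
    ∀ (w : List α) (c : M.tm.Cfg),
      StateTransition.Reaches M.tm.step
        (Turing.initList M.tm (w.map M.inputAlphabet.invFun)) c →
      ∑ k : M.tm.K, (Turing.TM2.Cfg.stk c k).length ≤ s.eval w.length

/-- A decision problem `D` on objects of type `I`, written as words by `enc`, is PSpace-hard: every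
language in PSpace, over any finite alphabet, has a polynomial-time many-one reduction to it. -/
def PSpaceHard {I Γ : Type} (enc : Computability.Encoding I Γ) (D : I → Prop) : Prop :=
  ∀ (α : Type) [Finite α] (L : Language α), InPSpace L →
    ∃ f : List α → I,
      Nonempty (Turing.TM2ComputableInPolyTime (id : List α → List α) enc.encode f) ∧
      ∀ w : List α, w ∈ L ↔ D (f w)

/-!
A language decided in polynomial space is reduced to Repeated Coverability in three steps.

**Turing machines to stack machines.** The multi-stack Turing machine is executed one instruction
at a time, as a `StackMachine`, which reads and modifies the top of one stack per step. It stays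
within a polynomial bound `B` on the heights of the stacks (`TM2Sim.reach_accepts_iff`).

**Stack machines to rule systems.** The control state is a cell, and for each height `j ≤ B` there
is a cell holding the symbols at height `j` on all the stacks. A letter is a guess of an
instruction and of the height at which it takes place; the control cell and the two cells around
this height verify the guess and update themselves. An accepting control state is reached within
the bound if and only if some word of letters is not refused by any cell and ends with an
accepting control state (`StackMachine.accepting_rules_iff`).

**Rule systems to protocols.** A *leader* runs rounds: it broadcasts `go`, a word of letters and
`finish`, and waits for one acknowledgement per cell, in a fixed order. The processes in charge of
a cell, which wait during a round, follow the letters, are lost in a sink if they refuse one or do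
not accept at `finish`, and otherwise return to an action state where they can acknowledge. If
some word is accepted, one leader and one process per cell repeat the same round for ever.
Conversely, only finitely many processes can be lost; when all losses have occurred, consider a
round of the leader. Its acknowledgements have been sent by at least one process for each cell,
all of which are waiting for `go`, since a `go` by a concurrent leader would have sent the waiting
leader to the sink. So all these processes start with the same `go`, read the same letters up to
the same `finish`, and none of them is lost, so that these letters form an accepted word
(`RuleSystem.repeatedlyCoverable_protocol_iff`).

The states, messages and transitions of the protocol fall into `B` blocks that are translates of
each other, apart from initial values depending on the input. Hence its presentation is written by
a program made of nested loops over unary counters. Such programs are compiled to multi-stack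
Turing machines with a control of the running time (`Generator.nonempty_computableInPolyTime`).
-/


/-! ### Rule systems and the protocol simulating them -/

/-- A family of `size` cells with values in `X`, the cell `j` starting with value `start j`. The
letters of `letters` act on all the cells simultaneously: `eff j a = none` means that the letter `a`
does not concern cell `j`, and `eff j a = some f` that it changes the value `x` of cell `j` into
`x'` if `f x = some x'`, and is forbidden if `f x = none`. -/
structure RuleSystem (X A : Type) where
  size : ℕ
  start : ℕ → X
  accepts : X → Bool
  letters : Set A
  eff : ℕ → A → Option (X → Option X)

namespace RuleSystem

variable {X A : Type}

/-- Some letter transforms the values `s` into `s'`. -/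
def Step (R : RuleSystem X A) (s s' : ℕ → X) : Prop :=
  ∃ a ∈ R.letters, ∀ j < R.size, (R.eff j a).elim (s' j = s j) (fun f => f (s j) = some (s' j))

/-- Values accepted by all the cells can be reached. -/
def Accepting (R : RuleSystem X A) : Prop :=
  ∃ s, Relation.ReflTransGen R.Step R.start s ∧ ∀ j < R.size, R.accepts (s j)

/-- The states of the simulating protocol. A process is a leader (`lead`, `relay`, `wait j`), or it
is in charge of one cell `j` (`ready j`, `idle j`, `cell j x`). -/
inductive St (X : Type) : Type
  | init
  | sink
  | lead
  | relay
  | wait (j : ℕ)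
  | ready (j : ℕ)
  | idle (j : ℕ)
  | cell (j : ℕ) (x : X)

/-- The messages of the simulating protocol. -/
inductive Msg (A : Type) : Type
  | tau
  | go
  | finish
  | ack (j : ℕ)
  | letter (a : A)

/-- The transitions of the simulating protocol. -/
inductive Tr (R : RuleSystem X A) : St X × Op (Msg A) × St X → Prop
  | joinLead : Tr R (.init, .bcast .tau, .wait 0)
  | join (j : ℕ) (hj : j < R.size) : Tr R (.init, .bcast .tau, .ready j)
  | ack (j : ℕ) (hj : j < R.size) : Tr R (.ready j, .bcast (.ack j), .idle j)
  | await (j : ℕ) (hj : j < R.size) : Tr R (.wait j, .recv (.ack j), .wait (j + 1))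
  | kill (j : ℕ) (hj : j < R.size) : Tr R (.wait j, .recv .go, .sink)
  | go : Tr R (.wait R.size, .bcast .go, .lead)
  | start (j : ℕ) (hj : j < R.size) : Tr R (.idle j, .recv .go, .cell j (R.start j))
  | letter (a : A) (ha : a ∈ R.letters) : Tr R (.lead, .bcast (.letter a), .relay)
  | relay : Tr R (.relay, .bcast .tau, .lead)
  | finish : Tr R (.lead, .bcast .finish, .wait 0)
  | check (j : ℕ) (hj : j < R.size) (x : X) :
      Tr R (.cell j x, .recv .finish, if R.accepts x then .ready j else .sink)
  | read (j : ℕ) (hj : j < R.size) (x : X) (a : A) (ha : a ∈ R.letters) (f : X → Option X)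
      (hf : R.eff j a = some f) :
      Tr R (.cell j x, .recv (.letter a), (f x).elim .sink (.cell j))

/-- The protocol simulating a rule system. In a round, a leader announces `go`, broadcasts letters,
announces `finish`, and waits for an acknowledgement from each cell. A process in charge of a
cell that sees a forbidden letter or stops with a value that is not accepted is lost for ever. -/
def protocol (R : RuleSystem X A) : Protocol (St X) (Msg A) where
  init := .init
  trans := {t | R.Tr t}

theorem mem_trans_protocol {R : RuleSystem X A} {t : St X × Op (Msg A) × St X} :
    t ∈ R.protocol.trans ↔ R.Tr t :=
  Iff.rfl

theorem waitOnly_protocol (R : RuleSystem X A) : R.protocol.WaitOnly := by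
  intro q
  cases q with
  | wait j =>
    by_cases hj : j < R.size
    · right
      rintro a q' (h : R.Tr _)
      cases h
      exact lt_irrefl _ hj
    · left
      rintro a q' (h : R.Tr _)
      cases h <;> exact hj ‹_›
  | _ => first
    | (left; rintro a q' (h : R.Tr _); cases h; done)
    | (right; rintro a q' (h : R.Tr _); cases h)

theorem isAction_init_protocol (R : RuleSystem X A) : R.protocol.IsAction R.protocol.init := by
  rintro ⟨a, q', h⟩
  change R.Tr (St.init, _, _) at h
  cases h

theorem noBroadcastSelfLoop_protocol (R : RuleSystem X A) : R.protocol.NoBroadcastSelfLoop := by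
  rintro q a (h : R.Tr _)
  cases h

end RuleSystem

/-! ### Infinite executions from cycles -/

theorem Relation.ReflTransGen.exists_seq {α : Type*} {r : α → α → Prop} {a b : α}
    (h : Relation.ReflTransGen r a b) :
    ∃ (n : ℕ) (c : ℕ → α), c 0 = a ∧ c n = b ∧ ∀ i < n, r (c i) (c (i + 1)) := by
  induction h with
  | refl => exact ⟨0, fun _ => a, rfl, rfl, by simp⟩
  | @tail b d _ hbd ih =>
    obtain ⟨n, c, h0, hn, hc⟩ := ih
    refine ⟨n + 1, fun i => if i ≤ n then c i else d, by simpa using h0, by simp, fun i hi => ?_⟩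
    rcases Nat.lt_or_ge i n with h | h
    · simpa [h.le, Nat.succ_le_of_lt h] using hc i h
    · obtain rfl : i = n := by omega
      simpa [hn] using hbd

/-- A path to `b` followed by a cycle through the step from `b` to `d`, repeated for ever. -/
theorem exists_seq_of_cycle {α : Type*} {r : α → α → Prop} {a b d : α}
    (hab : Relation.ReflTransGen r a b) (hbd : r b d) (hdb : Relation.ReflTransGen r d b) :
    ∃ c : ℕ → α, c 0 = a ∧ (∀ i, r (c i) (c (i + 1))) ∧
      ∀ i, ∃ j, i < j ∧ c j = b ∧ c (j + 1) = d := by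
  obtain ⟨n, p, p0, pn, hp⟩ := hab.exists_seq
  obtain ⟨m, q, q0, qm, hq⟩ := hdb.exists_seq
  -- the cycle, of length `m + 1`: from `b` to `d`, and along `q` back to `b`
  let cyc : ℕ → α := fun i => if i = 0 then b else q (i - 1)
  have hcyc : ∀ i, r (cyc (i % (m + 1))) (cyc ((i + 1) % (m + 1))) := by
    intro i
    have hlt := Nat.mod_lt i (Nat.succ_pos m)
    rw [Nat.add_mod i 1]
    generalize i % (m + 1) = t at hlt
    rcases Nat.eq_zero_or_pos m with rfl | hm
    · obtain rfl : t = 0 := by omega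
      have : d = b := q0.symm.trans qm
      subst this
      simpa [cyc] using hbd
    rw [Nat.mod_eq_of_lt (show 1 < m + 1 by omega)]
    rcases Nat.lt_or_ge t m with h | h
    · rw [Nat.mod_eq_of_lt (by omega)]
      rcases Nat.eq_zero_or_pos t with rfl | ht
      · simpa [cyc, q0] using hbd
      · have := hq (t - 1) (by omega)
        rw [Nat.sub_add_cancel ht] at this
        simpa [cyc, ht.ne'] using this
    · obtain rfl : t = m := by omega
      have := hq (t - 1) (by omega)
      rw [Nat.sub_add_cancel hm, qm] at this
      simpa [cyc, hm.ne'] using this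
  refine ⟨fun i => if i < n then p i else cyc ((i - n) % (m + 1)), ?_, fun i => ?_, fun i => ?_⟩
  · rcases Nat.eq_zero_or_pos n with rfl | h
    · simp [cyc, ← pn, p0]
    · simp [h, p0]
  · rcases Nat.lt_trichotomy (i + 1) n with h | h | h
    · simpa [h, show i < n by omega] using hp i (by omega)
    · have := hp i (by omega)
      rw [h, pn] at this
      simpa [cyc, h, show i < n by omega] using this
    · simpa [show ¬ i + 1 < n by omega, show ¬ i < n by omega,
        show i + 1 - n = i - n + 1 by omega] using hcyc (i - n)
  · refine ⟨n + (m + 1) * (i + 1), by nlinarith, by simp [cyc], ?_⟩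
    rcases Nat.eq_zero_or_pos m with rfl | hm
    · have : d = b := q0.symm.trans qm
      simp [cyc, show ¬ n + (i + 1) + 1 < n by omega, this, Nat.mod_one]
    · simp [add_assoc, Nat.mod_eq_of_lt (show 1 < m + 1 by omega), cyc, q0]

/-! ### Correctness of the simulating protocol -/

namespace RuleSystem

variable {X A : Type}

section Completeness

variable (R : RuleSystem X A)

/-- The configuration with one process in state `r j` for each cell `j`, and a last process, the
leader, in state `l`. -/
def conf (r : ℕ → St X) (l : St X) : Fin (R.size + 1) → St X :=
  fun p => if p.1 < R.size then r p.1 else l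

/-- A process in state `q` may be in state `q'` after a broadcast of `a` by another one. -/
def Reacts (q : St X) (a : Msg A) (q' : St X) : Prop :=
  R.Tr (q, .recv a, q') ∨ ((∀ p, ¬ R.Tr (q, .recv a, p)) ∧ q' = q)

variable {R}

theorem stepBy_conf_leader {r r' : ℕ → St X} {l l' : St X} {a : Msg A}
    (h : R.Tr (l, .bcast a, l')) (hr : ∀ j < R.size, R.Reacts (r j) a (r' j)) :
    R.protocol.StepBy (Fin.last R.size) l a l' (R.conf r l) (R.conf r' l') := by
  refine ⟨h, by simp [conf], by simp [conf], fun p hp => ?_⟩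
  have hp : p.1 < R.size := Fin.val_lt_last hp
  rcases hr p hp with h | ⟨h, h'⟩
  · left
    simpa [conf, hp, mem_trans_protocol] using h
  · right
    refine ⟨?_, by simpa [conf, hp] using h'⟩
    rintro ⟨q, hq⟩
    exact h q (by simpa [conf, hp, mem_trans_protocol] using hq)

theorem stepBy_conf_cell {r r' : ℕ → St X} {l l' : St X} {a : Msg A} {i : ℕ} (hi : i < R.size)
    (h : R.Tr (r i, .bcast a, r' i)) (hr : ∀ j < R.size, j ≠ i → R.Reacts (r j) a (r' j))
    (hl : R.Reacts l a l') :
    R.protocol.StepBy ⟨i, hi.trans (Nat.lt_succ_self _)⟩ (r i) a (r' i) (R.conf r l)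
      (R.conf r' l') := by
  refine ⟨h, by simp [conf, hi], by simp [conf, hi], fun p hp => ?_⟩
  by_cases hpN : p.1 < R.size
  · rcases hr p hpN (fun h => hp (Fin.ext h)) with h | ⟨h, h'⟩
    · left
      simpa [conf, hpN, mem_trans_protocol] using h
    · right
      refine ⟨?_, by simpa [conf, hpN] using h'⟩
      rintro ⟨q, hq⟩
      exact h q (by simpa [conf, hpN, mem_trans_protocol] using hq)
  · rcases hl with h | ⟨h, h'⟩
    · left
      simpa [conf, hpN, mem_trans_protocol] using h
    · right
      refine ⟨?_, by simpa [conf, hpN] using h'⟩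
      rintro ⟨q, hq⟩
      exact h q (by simpa [conf, hpN, mem_trans_protocol] using hq)

theorem Reacts.ignore {q : St X} {a : Msg A} (h : ∀ p, ¬ R.Tr (q, .recv a, p)) : R.Reacts q a q :=
  .inr ⟨h, rfl⟩

theorem Reacts.tau (q : St X) : R.Reacts q .tau q := by
  refine .ignore fun p h => ?_
  cases h

/-- Reachability between configurations of the protocol. -/
abbrev Reach (R : RuleSystem X A) {n : ℕ} : (Fin n → St X) → (Fin n → St X) → Prop :=
  Relation.ReflTransGen R.protocol.Step

theorem reach_ready :
    R.Reach (fun _ : Fin (R.size + 1) => .init) (R.conf .ready (.wait 0)) := by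
  have key : ∀ k ≤ R.size, R.Reach (fun _ : Fin (R.size + 1) => .init)
      (R.conf (fun j => if j < k then .ready j else .init) .init) := by
    intro k
    induction k with
    | zero =>
      intro _
      convert Relation.ReflTransGen.refl using 1
      funext p
      simp [conf]
    | succ k ih =>
      intro hk
      refine (ih (by omega)).tail ⟨_, _, _, _, stepBy_conf_cell (a := .tau) hk ?_ ?_ (.tau _)⟩
      · simpa using Tr.join k hk
      · intro j hj hjk
        simp only [show (j < k + 1) = (j < k) by grind]
        exact .tau _
  refine (key _ le_rfl).tail ⟨_, _, _, _, stepBy_conf_leader .joinLead ?_⟩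
  intro j hj
  simp only [hj, if_true]
  exact .tau _

theorem reach_idle :
    R.Reach (R.conf .ready (.wait 0)) (R.conf .idle (.wait R.size)) := by
  have key : ∀ k ≤ R.size, R.Reach (R.conf .ready (.wait 0))
      (R.conf (fun j => if j < k then .idle j else .ready j) (.wait k)) := by
    intro k
    induction k with
    | zero => intro _; simpa using Relation.ReflTransGen.refl
    | succ k ih =>
      intro hk
      refine (ih (by omega)).tail ⟨_, _, _, _, stepBy_conf_cell (a := .ack k) hk ?_ ?_
        (.inl (.await k hk))⟩
      · simpa using Tr.ack k hk
      · intro j hj hjk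
        simp only [show (j < k + 1) = (j < k) by grind]
        refine .ignore fun p h => ?_
        split_ifs at h <;> cases h
  convert key _ le_rfl using 1
  funext p
  by_cases hp : p.1 < R.size <;> simp [conf, hp]

theorem reach_start :
    R.Reach (R.conf .idle (.wait R.size)) (R.conf (fun j => .cell j (R.start j)) .lead) :=
  .single ⟨_, _, _, _, stepBy_conf_leader .go fun j hj => .inl (.start j hj)⟩

theorem reach_of_step {s s' : ℕ → X} (h : R.Step s s') :
    R.Reach (R.conf (fun j => .cell j (s j)) .lead) (R.conf (fun j => .cell j (s' j)) .lead) := by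
  obtain ⟨a, ha, h⟩ := h
  refine .tail (.single ⟨_, _, _, _, stepBy_conf_leader (.letter a ha)
    (r' := fun j => .cell j (s' j)) fun j hj => ?_⟩)
    ⟨_, _, _, _, stepBy_conf_leader .relay fun j hj => .tau _⟩
  have := h j hj
  cases hf : R.eff j a with
  | none =>
    simp only [hf, Option.elim_none] at this
    rw [this]
    refine .ignore fun p hp => ?_
    cases hp with
    | read _ _ _ _ _ f hf' => simp [hf] at hf'
  | some f =>
    simp only [hf, Option.elim_some] at this
    left
    simpa [this] using Tr.read j hj (s j) a ha f hf

theorem repeatedlyCoverable_of_accepting (h : R.Accepting) :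
    R.protocol.RepeatedlyCoverable .lead .finish (.wait 0) := by
  obtain ⟨s, hs, hacc⟩ := h
  have h2 : R.Reach (R.conf .ready (.wait 0)) (R.conf (fun j => .cell j (s j)) .lead) := by
    refine (reach_idle.trans reach_start).trans ?_
    clear hacc
    induction hs with
    | refl => exact .refl
    | tail _ h ih => exact ih.trans (reach_of_step h)
  have h3 : R.protocol.StepBy (Fin.last R.size) .lead .finish (.wait 0)
      (R.conf (fun j => .cell j (s j)) .lead) (R.conf .ready (.wait 0)) := by
    refine stepBy_conf_leader .finish fun j hj => .inl ?_
    simpa [hacc j hj] using Tr.check j hj (s j)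
  obtain ⟨ρ, h0, hρ, hinf⟩ := exists_seq_of_cycle (reach_ready.trans h2) ⟨_, _, _, _, h3⟩ h2
  refine ⟨R.size + 1, by omega, ρ, ⟨fun e => by rw [h0]; rfl, hρ⟩, Fin.last _, fun i => ?_⟩
  obtain ⟨j, hj, hb, hd⟩ := hinf i
  exact ⟨j, hj, by rw [hb, hd]; exact h3⟩

end Completeness

section Soundness

variable {R : RuleSystem X A} {n : ℕ}

/-- For each cell, some process holds its value in `s`, where `s` is reachable. -/
def Running (R : RuleSystem X A) (C : Fin n → St X) : Prop :=
  ∃ s, Relation.ReflTransGen R.Step R.start s ∧ ∀ j < R.size, ∃ p, C p = .cell j (s j)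

/-- The invariant of a round of the leader `e`: while it waits for the acknowledgement of cell `j`,
processes are ready to start in all the cells below `j`, and while it broadcasts letters, the cells
hold reachable values. As another leader may announce `go` first, the cells may be
running already when `e` is about to do so. -/
def RoundInv (R : RuleSystem X A) (e : Fin n) (C : Fin n → St X) : Prop :=
  (∃ j ≤ R.size, C e = .wait j ∧ ((∀ i < j, ∃ p, C p = .idle i) ∨ (j = R.size ∧ R.Running C))) ∨
    ((C e = .lead ∨ C e = .relay) ∧ R.Running C)

variable {C C' : Fin n → St X} {e₀ : Fin n} {q q' : St X} {a : Msg A}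

theorem idle_of_stepBy (h : R.protocol.StepBy e₀ q a q' C C') {p : Fin n} {i : ℕ}
    (hp : C p = .idle i) (ha : a ≠ .go) : C' p = .idle i := by
  obtain ⟨hq, h1, h2, h3⟩ := h
  replace hq : R.Tr (q, .bcast a, q') := hq
  by_cases hpe : p = e₀
  · subst hpe
    rw [← h1, hp] at hq
    cases hq
  · rcases h3 p hpe with h | h
    · replace h : R.Tr _ := h
      rw [hp] at h
      generalize C' p = x at h
      cases h
      exact absurd rfl ha
    · rw [h.2, hp]

theorem start_of_stepBy (h : R.protocol.StepBy e₀ q .go q' C C') {p : Fin n} {i : ℕ}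
    (hp : C p = .idle i) (hi : i < R.size) : C' p = .cell i (R.start i) := by
  obtain ⟨hq, h1, h2, h3⟩ := h
  replace hq : R.Tr (q, .bcast .go, q') := hq
  by_cases hpe : p = e₀
  · subst hpe
    rw [← h1, hp] at hq
    cases hq
  · rcases h3 p hpe with h | h
    · replace h : R.Tr _ := h
      rw [hp] at h
      generalize C' p = x at h
      cases h
      rfl
    · exact absurd ⟨_, by rw [hp]; exact Tr.start i hi⟩ h.1

theorem cell_of_stepBy (h : R.protocol.StepBy e₀ q a q' C C') {p : Fin n} {i : ℕ} {x : X}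
    (hp : C p = .cell i x) : R.Reacts (.cell i x) a (C' p) := by
  obtain ⟨hq, h1, h2, h3⟩ := h
  replace hq : R.Tr (q, .bcast a, q') := hq
  by_cases hpe : p = e₀
  · subst hpe
    rw [← h1, hp] at hq
    cases hq
  · rcases h3 p hpe with h | h
    · left
      rw [← hp]
      exact h
    · right
      rw [← hp]
      exact ⟨fun q' hq' => h.1 ⟨q', hq'⟩, h.2⟩

/-- Without new losses, the cells keep running, and accept when `finish` is announced. -/
theorem Running.step (hC : R.Running C) (h : R.protocol.StepBy e₀ q a q' C C')
    (hsink : ∀ p, C' p = .sink → C p = .sink) :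
    R.Running C' ∧ (a ≠ .finish) ∨ R.Accepting := by
  obtain ⟨s, hs, hC⟩ := hC
  by_cases hfinish : a = .finish
  · right
    subst hfinish
    refine ⟨s, hs, fun j hj => ?_⟩
    obtain ⟨p, hp⟩ := hC j hj
    rcases cell_of_stepBy h hp with h | h
    · by_contra hacc
      have : C' p = .sink := by
        generalize C' p = x at h
        cases h
        simp [hacc]
      simp [hsink p this] at hp
    · exact absurd (Tr.check j hj _) (h.1 _)
  left
  refine ⟨?_, hfinish⟩
  by_cases hlet : ∃ b, a = .letter b
  · obtain ⟨b, rfl⟩ := hlet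
    have hb : b ∈ R.letters := by
      have hq : R.Tr _ := h.1
      cases hq
      assumption
    have key : ∀ j < R.size, ∃ x', (∃ p, C' p = .cell j x') ∧
        (R.eff j b).elim (x' = s j) (fun f => f (s j) = some x') := by
      intro j hj
      obtain ⟨p, hp⟩ := hC j hj
      rcases cell_of_stepBy h hp with h | h
      · cases hf : R.eff j b with
        | none =>
          generalize C' p = x at h
          cases h with
          | read _ _ _ _ _ f hf' => simp [hf] at hf'
        | some f =>
          cases hx : f (s j) with
          | none =>
            have : C' p = .sink := by
              generalize C' p = x at h
              cases h with
              | read _ _ _ _ _ f' hf' =>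
                obtain rfl : f = f' := by simpa [hf] using hf'
                simp [hx]
            simp [hsink p this] at hp
          | some x' =>
            refine ⟨x', ⟨p, ?_⟩, hx⟩
            generalize C' p = x at h
            cases h with
            | read _ _ _ _ _ f' hf' =>
              obtain rfl : f = f' := by simpa [hf] using hf'
              simp [hx]
      · cases hf : R.eff j b with
        | none => exact ⟨s j, ⟨p, h.2⟩, rfl⟩
        | some f => exact absurd (Tr.read j hj _ b hb f hf) (h.1 _)
    have : Nonempty X := ⟨s 0⟩
    choose! s' hs' hstep using key
    exact ⟨s', hs.tail ⟨b, hb, hstep⟩, hs'⟩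
  · refine ⟨s, hs, fun j hj => ?_⟩
    obtain ⟨p, hp⟩ := hC j hj
    refine ⟨p, ?_⟩
    rcases cell_of_stepBy h hp with h | h
    · generalize C' p = x at h
      cases h
      · exact absurd rfl hfinish
      · exact absurd ⟨_, rfl⟩ hlet
    · exact h.2

theorem RoundInv.step {e : Fin n} (hC : R.RoundInv e C) (hstep : R.protocol.Step C C')
    (hsink : ∀ p, C' p = .sink → C p = .sink) (hacc : ¬ R.Accepting) : R.RoundInv e C' := by
  obtain ⟨e₀, q, a, q', h⟩ := hstep
  have hrun : R.Running C → R.Running C' ∧ a ≠ .finish := fun h' =>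
    (h'.step h hsink).resolve_right hacc
  obtain ⟨hq, h1, h2, h3⟩ := id h
  replace hq : R.Tr (q, .bcast a, q') := hq
  rcases hC with ⟨j, hj, hCe, hC⟩ | ⟨hCe, hC⟩
  · by_cases he : e = e₀
    · subst he
      rw [← h1, hCe] at hq
      obtain ⟨rfl, rfl, rfl⟩ : a = .go ∧ q' = .lead ∧ j = R.size := by
        cases hq
        exact ⟨rfl, rfl, rfl⟩
      refine .inr ⟨.inl h2, ?_⟩
      rcases hC with hC | ⟨-, hC⟩
      · refine ⟨_, .refl, fun i hi => ?_⟩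
        obtain ⟨p, hp⟩ := hC i hi
        exact ⟨p, start_of_stepBy h hp hi⟩
      · exact (hrun hC).1
    · rcases h3 e he with h' | ⟨h', hCe'⟩
      · replace h' : R.Tr _ := h'
        rw [hCe] at h'
        have hjN : j < R.size := by
          generalize C' e = x at h'
          cases h' <;> assumption
        have ha : a = .ack j ∧ C' e = .wait (j + 1) := by
          have hne : C' e ≠ .sink := fun hs => by simp [hsink e hs] at hCe
          generalize C' e = x at h' hne
          cases h'
          · exact ⟨rfl, rfl⟩
          · exact absurd rfl hne
        obtain ⟨rfl, hCe'⟩ := ha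
        refine .inl ⟨j + 1, hjN, hCe', .inl fun i hi => ?_⟩
        rcases Nat.lt_succ_iff_lt_or_eq.1 hi with hi | rfl
        · rcases hC with hC | hC
          · obtain ⟨p, hp⟩ := hC i hi
            exact ⟨p, idle_of_stepBy h hp (by simp)⟩
          · omega
        · refine ⟨e₀, ?_⟩
          rw [h2]
          cases hq
          rfl
      · refine .inl ⟨j, hj, hCe'.trans hCe, ?_⟩
        rcases hC with hC | ⟨hjN, hC⟩
        · by_cases ha : a = .go
          · subst ha
            -- a leader waiting for an acknowledgement would have received `go`
            have hjN : j = R.size := by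
              by_contra hne
              exact h' ⟨_, by rw [hCe]; exact Tr.kill j (by omega)⟩
            refine .inr ⟨hjN, _, .refl, fun i hi => ?_⟩
            obtain ⟨p, hp⟩ := hC i (by omega)
            exact ⟨p, start_of_stepBy h hp hi⟩
          · left
            intro i hi
            obtain ⟨p, hp⟩ := hC i hi
            exact ⟨p, idle_of_stepBy h hp ha⟩
        · exact .inr ⟨hjN, (hrun hC).1⟩
  · refine .inr ⟨?_, (hrun hC).1⟩
    have hfinish := (hrun hC).2
    by_cases he : e = e₀
    · subst he
      rw [h2]
      rw [← h1] at hq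
      rcases hCe with hCe | hCe <;> rw [hCe] at hq <;> cases hq
      · exact .inr rfl
      · exact absurd rfl hfinish
      · exact .inl rfl
    · rcases h3 e he with h' | ⟨-, h'⟩
      · replace h' : R.Tr _ := h'
        rcases hCe with hCe | hCe <;> rw [hCe] at h' <;> generalize C' e = x at h' <;> cases h'
      · rwa [h']

/-- From some time on, no process is lost. -/
theorem exists_forall_sink_of_isInfExecution {ρ : ℕ → Fin n → St X}
    (h : R.protocol.IsInfExecution ρ) :
    ∃ N, ∀ i ≥ N, ∀ p, ρ (i + 1) p = .sink → ρ i p = .sink := by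
  have hmono : ∀ i p, ρ i p = .sink → ρ (i + 1) p = .sink := by
    intro i p hp
    obtain ⟨e₀, q, a, q', hq, h1, h2, h3⟩ := h.2 i
    by_cases hpe : p = e₀
    · subst hpe
      replace hq : R.Tr (q, .bcast a, q') := hq
      rw [← h1, hp] at hq
      cases hq
    · rcases h3 p hpe with h | h
      · replace h : R.Tr _ := h
        rw [hp] at h
        generalize ρ (i + 1) p = x at h
        cases h
      · rw [h.2, hp]
  have hmono' : ∀ p i j, i ≤ j → ρ i p = .sink → ρ j p = .sink := by
    intro p i j hij hi
    induction hij with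
    | refl => exact hi
    | step _ ih => exact hmono _ p ih
  have : ∀ p, ∃ N, ∀ i ≥ N, ρ (i + 1) p = .sink → ρ i p = .sink := by
    intro p
    by_cases hp : ∃ N, ρ N p = .sink
    · obtain ⟨N, hN⟩ := hp
      exact ⟨N, fun i hi _ => hmono' p N i hi hN⟩
    · push Not at hp
      exact ⟨0, fun i _ hi => absurd hi (hp _)⟩
  choose N hN using this
  exact ⟨Finset.univ.sup N, fun i hi p => hN p i (le_trans (Finset.le_sup (Finset.mem_univ p)) hi)⟩

theorem accepting_of_repeatedlyCoverable
    (h : R.protocol.RepeatedlyCoverable .lead .finish (.wait 0)) : R.Accepting := by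
  obtain ⟨n, -, ρ, hρ, e, hinf⟩ := h
  obtain ⟨N, hN⟩ := exists_forall_sink_of_isInfExecution hρ
  by_contra hacc
  obtain ⟨j₁, hj₁, ht₁⟩ := hinf N
  obtain ⟨j₂, hj₂, ht₂⟩ := hinf j₁
  have hinv : ∀ k, R.RoundInv e (ρ (j₁ + 1 + k)) := by
    intro k
    induction k with
    | zero => exact .inl ⟨0, Nat.zero_le _, ht₁.2.2.1, .inl (by simp)⟩
    | succ k ih => exact ih.step (hρ.2 _) (hN _ (show N ≤ j₁ + 1 + k by omega)) hacc
  obtain ⟨k, rfl⟩ : ∃ k, j₂ = j₁ + 1 + k := ⟨j₂ - (j₁ + 1), by omega⟩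
  rcases hinv k with ⟨j, -, h, -⟩ | ⟨-, h⟩
  · simp [ht₂.2.1] at h
  · rcases h.step ht₂ (hN _ (by omega)) with h | h
    · exact h.2 rfl
    · exact hacc h

theorem repeatedlyCoverable_protocol_iff :
    R.protocol.RepeatedlyCoverable .lead .finish (.wait 0) ↔ R.Accepting :=
  ⟨accepting_of_repeatedlyCoverable, repeatedlyCoverable_of_accepting⟩

end Soundness

end RuleSystem

/-! ### Bounded stack machines as rule systems -/

/-- What an elementary instruction does to the top of a stack. -/
inductive StackAct (G : Type) : Type
  | push (g : G)
  | pop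
  | stay

/-- The stack after an action. -/
def StackAct.app {G : Type} : StackAct G → List G → List G
  | push g, l => g :: l
  | pop, l => l.tail
  | stay, l => l

/-- A machine with stacks `k : K` over `G` and control states in `C`: in state `c`, the top symbol
`y` of the stack `stk c` is read (`none` if it is empty), the action `act c y` is applied to this
stack, and the control state becomes `nxt c y`. -/
structure StackMachine (K C G : Type) where
  init : C
  stk : C → K
  nxt : C → Option G → C
  act : C → Option G → StackAct G
  accepts : C → Bool

namespace StackMachine

variable {K C G : Type}

/-- `content l j` describes the cell `j` of a tape on which the stack `l` is written, from its bottom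
up, after a bottom marker `some none` in cell `0`. The cells above the top are blank (`none`). -/
def content : List G → ℕ → Option (Option G)
  | [], j => if j = 0 then some none else none
  | g :: l, j => if j = l.length + 1 then some (some g) else content l j

theorem content_eq_none_iff {l : List G} {j : ℕ} : content l j = none ↔ l.length < j := by
  induction l with
  | nil => simp [content, Nat.pos_iff_ne_zero]
  | cons g l ih =>
    by_cases h : j = l.length + 1
    · simp [content, h]
    · simp only [content, h, if_false, ih, List.length_cons]
      omega

theorem content_length (l : List G) : content l l.length = some l.head? := by
  cases l <;> simp [content]

theorem content_zero (l : List G) : content l 0 = some none := by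
  induction l with
  | nil => rfl
  | cons g l ih => simpa [content] using ih

theorem content_succ (l : List G) (j : ℕ) : content l (j + 1) = (l.reverse[j]?).map some := by
  induction l with
  | nil => simp [content]
  | cons g l ih =>
    rw [content, List.reverse_cons, List.getElem?_append, List.length_reverse]
    split_ifs with h1 h2 h2
    · omega
    · obtain rfl : j = l.length := by omega
      simp
    · exact ih
    · rw [ih, List.getElem?_eq_none (by simp; omega), List.getElem?_eq_none (by simp; omega)]

theorem eq_length_of_content {l : List G} {j : ℕ} {y : Option G} (h : content l j = some y)
    (h' : content l (j + 1) = none) : j = l.length ∧ y = l.head? := by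
  have h1 : ¬ l.length < j := fun hlt => by
    rw [content_eq_none_iff.2 hlt] at h
    cases h
  rw [content_eq_none_iff] at h'
  obtain rfl : j = l.length := by omega
  rw [content_length] at h
  exact ⟨rfl, (Option.some.inj h).symm⟩

/-- The new content of the topmost nonblank cell, whose content is `y`. -/
def topAfter : StackAct G → Option G → Option (Option G)
  | .pop, some _ => none
  | _, y => some y

/-- The new content of the lowest blank cell. -/
def blankAfter : StackAct G → Option (Option G)
  | .push g => some (some g)
  | _ => none

theorem content_app (a : StackAct G) (l : List G) (j : ℕ) :
    content (a.app l) j = if j = l.length then topAfter a l.head? else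
      if j = l.length + 1 then blankAfter a else content l j := by
  cases a with
  | push g =>
    by_cases h : j = l.length
    · subst h
      simp [StackAct.app, content, topAfter, content_length]
    · by_cases h' : j = l.length + 1 <;> simp [StackAct.app, content, h, h', blankAfter]
  | pop =>
    cases l with
    | nil =>
      by_cases h : j = 0
      · simp [h, StackAct.app, content, topAfter]
      · simp [h, StackAct.app, content, blankAfter]
    | cons g l =>
      by_cases h : j = l.length + 1
      · simp [h, StackAct.app, topAfter, content_eq_none_iff]
      · by_cases h' : j = l.length + 1 + 1
        · simp [h', StackAct.app, blankAfter, content_eq_none_iff]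
        · simp [h, h', StackAct.app, content]
  | stay =>
    by_cases h : j = l.length
    · subst h
      simp [StackAct.app, topAfter, content_length]
    · by_cases h' : j = l.length + 1
      · simp [h', StackAct.app, blankAfter, content_eq_none_iff]
      · simp [h, h', StackAct.app]

variable [DecidableEq K]

/-- One elementary instruction. -/
def step (M : StackMachine K C G) (s : C × (K → List G)) : C × (K → List G) :=
  (M.nxt s.1 (s.2 (M.stk s.1)).head?,
    Function.update s.2 (M.stk s.1)
      ((M.act s.1 (s.2 (M.stk s.1)).head?).app (s.2 (M.stk s.1))))

/-- One elementary instruction, on a stack of height less than `B`. -/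
def BStep (M : StackMachine K C G) (B : ℕ) (s s' : C × (K → List G)) : Prop :=
  (s.2 (M.stk s.1)).length < B ∧ s' = M.step s

/-- The values of the cells of the rule system: the cell `0` holds the control state, and the cell
`j + 1` holds the cell `j` of the tapes of all the stacks. -/
abbrev Val (K C G : Type) : Type :=
  C ⊕ (K → Option (Option G))

/-- The values describing a configuration. -/
def values (s : C × (K → List G)) : ℕ → Val K C G
  | 0 => .inl s.1
  | j + 1 => .inr fun k => content (s.2 k) j

variable [DecidableEq C] [DecidableEq G]

/-- The effect on the control state of the instruction for state `c` and top symbol `y`. -/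
def effControl (M : StackMachine K C G) (c : C) (y : Option G) : Val K C G → Option (Val K C G)
  | .inl c' => if c' = c then some (.inl (M.nxt c y)) else none
  | .inr _ => none

/-- The effect of an instruction on the cell that should contain the top of the stack. -/
def effTop (M : StackMachine K C G) (c : C) (y : Option G) : Val K C G → Option (Val K C G)
  | .inl _ => none
  | .inr t => if t (M.stk c) = some y then
      some (.inr (Function.update t (M.stk c) (topAfter (M.act c y) y))) else none

/-- The effect of an instruction on the cell that should be the lowest blank one. -/
def effBlank (M : StackMachine K C G) (c : C) (y : Option G) : Val K C G → Option (Val K C G)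
  | .inl _ => none
  | .inr t => if t (M.stk c) = none then
      some (.inr (Function.update t (M.stk c) (blankAfter (M.act c y)))) else none

/-- The rule system of a machine, started on the stacks `S`, whose stack heights are bounded by `B`.
The letter `(h, c, y)` is the instruction for control state `c` and top symbol `y`, applied to a stack
of height `h`; the cells verify that this is the situation. -/
def rules (M : StackMachine K C G) (S : K → List G) (B : ℕ) :
    RuleSystem (Val K C G) (ℕ × C × Option G) where
  size := B + 2
  start := values (M.init, S)
  accepts := Sum.elim M.accepts fun _ => true
  letters := {a | a.1 < B}
  eff j a := if j = 0 then some (M.effControl a.2.1 a.2.2) else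
    if j = a.1 + 1 then some (M.effTop a.2.1 a.2.2) else
    if j = a.1 + 2 then some (M.effBlank a.2.1 a.2.2) else none

variable (M : StackMachine K C G) (S : K → List G) (B : ℕ)

theorem eff_values (s : C × (K → List G)) (j : ℕ) :
    ((M.rules S B).eff j ((s.2 (M.stk s.1)).length, s.1, (s.2 (M.stk s.1)).head?)).elim
      (values (M.step s) j = values s j) (fun f => f (values s j) = some (values (M.step s) j)) := by
  cases j with
  | zero => simp [rules, values, effControl, step]
  | succ j =>
    simp only [rules, Nat.add_eq_zero_iff, one_ne_zero, and_false, if_false, Nat.add_right_cancel_iff,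
      show j + 1 = (s.2 (M.stk s.1)).length + 2 ↔ j = (s.2 (M.stk s.1)).length + 1 by omega]
    split_ifs with h h'
    · subst h
      simp only [Option.elim_some, values, effTop, content_length, if_true, Option.some.injEq,
        Sum.inr.injEq]
      funext k
      by_cases hk : k = M.stk s.1
      · subst hk
        simp [step, content_app]
      · simp [step, hk]
    · subst h'
      simp only [Option.elim_some, values, effBlank, content_eq_none_iff.2 (Nat.lt_succ_self _),
        if_true, Option.some.injEq, Sum.inr.injEq]
      funext k
      by_cases hk : k = M.stk s.1
      · subst hk
        simp [step, content_app]
      · simp [step, hk]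
    · simp only [Option.elim_none, values, Sum.inr.injEq]
      funext k
      by_cases hk : k = M.stk s.1
      · subst hk
        simp [step, content_app, h, h']
      · simp [step, hk]

theorem step_rules_of_bStep {s s' : C × (K → List G)} (h : M.BStep B s s') :
    (M.rules S B).Step (values s) (values s') := by
  obtain ⟨h, rfl⟩ := h
  exact ⟨_, h, fun j _ => M.eff_values S B s j⟩

theorem bStep_of_step_rules {s : C × (K → List G)} {v v' : ℕ → Val K C G}
    (hv : ∀ j < B + 2, v j = values s j) (h : (M.rules S B).Step v v') :
    M.BStep B s (M.step s) ∧ ∀ j < B + 2, v' j = values (M.step s) j := by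
  obtain ⟨⟨i, c, y⟩, hi, h⟩ := h
  replace hi : i < B := hi
  replace h : ∀ j < B + 2, _ := h
  have h0 := h 0 (by omega)
  have h1 := h (i + 1) (by omega)
  have h2 := h (i + 2) (by omega)
  rw [hv _ (by omega)] at h0 h1 h2
  have hc : s.1 = c := by
    by_contra hc
    simp [rules, effControl, values, hc] at h0
  subst hc
  have htop : content (s.2 (M.stk s.1)) i = some y := by
    by_contra hne
    simp [rules, effTop, values, hne] at h1
  have hblank : content (s.2 (M.stk s.1)) (i + 1) = none := by
    by_contra hne
    simp [rules, effBlank, values, hne] at h2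
  obtain ⟨rfl, rfl⟩ := eq_length_of_content htop hblank
  refine ⟨⟨hi, rfl⟩, fun j hj => ?_⟩
  have h3 := h j hj
  have h4 := M.eff_values S B s j
  rw [hv j hj] at h3
  revert h3 h4
  generalize (M.rules S B).eff j _ = o
  cases o with
  | none => simp only [Option.elim_none]; exact fun h3 h4 => h3.trans h4.symm
  | some f => simp only [Option.elim_some]; exact fun h3 h4 => Option.some.inj (h3.symm.trans h4)

theorem accepting_rules_iff :
    (M.rules S B).Accepting ↔
      ∃ s, Relation.ReflTransGen (M.BStep B) (M.init, S) s ∧ M.accepts s.1 := by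
  constructor
  · rintro ⟨v, hv, hacc⟩
    have : ∃ s, Relation.ReflTransGen (M.BStep B) (M.init, S) s ∧
        ∀ j < B + 2, v j = values s j := by
      clear hacc
      induction hv with
      | refl => exact ⟨_, .refl, fun _ _ => rfl⟩
      | tail _ h ih =>
        obtain ⟨s, hs, hv⟩ := ih
        obtain ⟨h1, h2⟩ := M.bStep_of_step_rules S B hv h
        exact ⟨_, hs.tail h1, h2⟩
    obtain ⟨s, hs, hv⟩ := this
    refine ⟨s, hs, ?_⟩
    have := hacc 0 (show 0 < B + 2 by omega)
    rw [hv 0 (by omega)] at this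
    exact this
  · rintro ⟨s, hs, hacc⟩
    refine ⟨values s, ?_, fun j _ => ?_⟩
    · clear hacc
      induction hs with
      | refl => exact .refl
      | tail _ h ih => exact ih.tail (M.step_rules_of_bStep S B h)
    · cases j with
      | zero => exact hacc
      | succ j => rfl

end StackMachine

/-! ### Multi-stack Turing machines as stack machines -/

namespace TM2Sim

open Turing

/-- The statements occurring in the program of `tm`, subprograms included. -/
def Sub (tm : FinTM2) : Type :=
  {q : TM2.Stmt tm.Γ tm.Λ tm.σ // ∃ l, q ∈ TM2.stmts₁ (tm.m l)}

/-- The control states of the stack machine: a statement that remains to be executed together with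
an internal state, or the final answer. -/
def Ctl (tm : FinTM2) : Type :=
  (Sub tm × tm.σ) ⊕ Bool

/-- The stack symbols of the stack machine. The alphabets of the stacks of `tm` need not be finite,
so that a symbol pushed by the program is represented by the push statement and the internal state
that produced it. -/
def Symb (tm : FinTM2) : Type :=
  (Sub tm × tm.σ) ⊕ tm.Γ tm.k₀

variable {tm : FinTM2}

instance : Finite (Sub tm) := by
  have := tm.ΛFin
  have : Set.Finite {q : TM2.Stmt tm.Γ tm.Λ tm.σ | ∃ l, q ∈ TM2.stmts₁ (tm.m l)} := by
    refine (Set.finite_iUnion fun l => Finset.finite_toSet (TM2.stmts₁ (tm.m l))).subset ?_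
    rintro q ⟨l, hl⟩
    exact Set.mem_iUnion.2 ⟨l, hl⟩
  exact this.to_subtype

instance : Finite (Ctl tm) := by
  have := tm.σFin
  exact inferInstanceAs (Finite ((Sub tm × tm.σ) ⊕ Bool))

instance : Finite (Symb tm) := by
  have := tm.σFin
  have := tm.Γk₀Fin
  exact inferInstanceAs (Finite ((Sub tm × tm.σ) ⊕ tm.Γ tm.k₀))

noncomputable instance : DecidableEq (Ctl tm) :=
  Classical.decEq _

noncomputable instance : DecidableEq (Symb tm) :=
  Classical.decEq _

theorem exists_mem_stmts₁_of_mem {q q' : TM2.Stmt tm.Γ tm.Λ tm.σ} (h : q' ∈ TM2.stmts₁ q)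
    (hq : ∃ l, q ∈ TM2.stmts₁ (tm.m l)) : ∃ l, q' ∈ TM2.stmts₁ (tm.m l) := by
  obtain ⟨l, hl⟩ := hq
  exact ⟨l, TM2.stmts₁_trans hl h⟩

/-- The symbol of the stack `k` represented by a symbol of the stack machine. -/
def decode (k : tm.K) : Symb tm → Option (tm.Γ k)
  | .inl (⟨.push k' f _, _⟩, v) => if h : k' = k then some (h ▸ f v) else none
  | .inl _ => none
  | .inr x => if h : tm.k₀ = k then some (h ▸ x) else none

/-- The stack concerned by a statement; when there is none, the output stack. -/
def stkOf : TM2.Stmt tm.Γ tm.Λ tm.σ → tm.K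
  | .push k _ _ => k
  | .peek k _ _ => k
  | .pop k _ _ => k
  | _ => tm.k₁

/-- Executing the first instruction of a statement, with top symbol `y`. At a halting statement,
the answer is read off the output stack. -/
def nxtOf (e : tm.Γ tm.k₁ ≃ Bool) (y : Option (Symb tm)) (v : tm.σ) :
    (q : TM2.Stmt tm.Γ tm.Λ tm.σ) → (∃ l, q ∈ TM2.stmts₁ (tm.m l)) → Ctl tm
  | .push k f q, h => .inl (⟨q, exists_mem_stmts₁_of_mem
      (by simp [TM2.stmts₁, TM2.stmts₁_self]) h⟩, v)
  | .peek k f q, h => .inl (⟨q, exists_mem_stmts₁_of_mem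
      (by simp [TM2.stmts₁, TM2.stmts₁_self]) h⟩, f v (y.bind (decode k)))
  | .pop k f q, h => .inl (⟨q, exists_mem_stmts₁_of_mem
      (by simp [TM2.stmts₁, TM2.stmts₁_self]) h⟩, f v (y.bind (decode k)))
  | .load f q, h => .inl (⟨q, exists_mem_stmts₁_of_mem
      (by simp [TM2.stmts₁, TM2.stmts₁_self]) h⟩, f v)
  | .branch f q₁ q₂, h => .inl (bif f v then ⟨q₁, exists_mem_stmts₁_of_mem
      (by simp [TM2.stmts₁, TM2.stmts₁_self]) h⟩ else ⟨q₂, exists_mem_stmts₁_of_mem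
      (by simp [TM2.stmts₁, TM2.stmts₁_self]) h⟩, v)
  | .goto f, _ => .inl (⟨tm.m (f v), f v, TM2.stmts₁_self⟩, v)
  | .halt, _ => .inr (((y.bind (decode tm.k₁)).map e).getD false)

/-- The action of the first instruction of a statement on the stack `stkOf`. -/
def actOf (c : Sub tm × tm.σ) : StackAct (Symb tm) :=
  match c.1.1 with
  | .push _ _ _ => .push (.inl c)
  | .pop _ _ _ => .pop
  | _ => .stay

/-- The stack machine executing the program of `tm` one instruction at a time. -/
def machine (tm : FinTM2) (e : tm.Γ tm.k₁ ≃ Bool) : StackMachine tm.K (Ctl tm) (Symb tm) where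
  init := .inl (⟨tm.m tm.main, tm.main, TM2.stmts₁_self⟩, tm.initialState)
  stk := Sum.elim (fun c => stkOf c.1.1) fun _ => tm.k₁
  nxt := Sum.elim (fun c y => nxtOf e y c.2 c.1.1 c.1.2) fun b _ => .inr b
  act := Sum.elim (fun c _ => actOf c) fun _ _ => .stay
  accepts := Sum.elim (fun _ => false) id

/-- The stacks `S'` of the stack machine represent the stacks `S` of `tm`. -/
def Represents (S' : tm.K → List (Symb tm)) (S : ∀ k, List (tm.Γ k)) : Prop :=
  ∀ k, (S' k).map (decode k) = (S k).map some

/-- The number of instructions in a statement, as a bound on its number of pushes. -/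
def size : TM2.Stmt tm.Γ tm.Λ tm.σ → ℕ
  | .push _ _ q => size q + 1
  | .peek _ _ q => size q + 1
  | .pop _ _ q => size q + 1
  | .load _ q => size q + 1
  | .branch _ q₁ q₂ => size q₁ + size q₂ + 1
  | .goto _ => 0
  | .halt => 0

/-- The control state in which the stack machine starts to simulate the next step of `tm`. -/
def Control (c : Ctl tm) (cfg : TM2.Cfg tm.Γ tm.Λ tm.σ) : Prop :=
  match cfg.l with
  | some l => c = .inl (⟨tm.m l, l, TM2.stmts₁_self⟩, cfg.var)
  | none => ∃ h, c = .inl (⟨.halt, h⟩, cfg.var)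

theorem Represents.length {S' : tm.K → List (Symb tm)} {S : ∀ k, List (tm.Γ k)}
    (h : Represents S' S) (k : tm.K) : (S' k).length = (S k).length := by
  simpa using congrArg List.length (h k)

theorem Represents.head {S' : tm.K → List (Symb tm)} {S : ∀ k, List (tm.Γ k)}
    (h : Represents S' S) (k : tm.K) : (S' k).head?.bind (decode k) = (S k).head? := by
  have := h k
  cases h1 : S' k <;> cases h2 : S k <;> simp_all

theorem Represents.tail {S' : tm.K → List (Symb tm)} {S : ∀ k, List (tm.Γ k)}
    (h : Represents S' S) (k : tm.K) :
    Represents (Function.update S' k (S' k).tail) (Function.update S k (S k).tail) := by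
  intro k'
  by_cases hk : k' = k
  · subst hk
    simp [List.map_tail, h k']
  · simp [hk, h k']

theorem Represents.push {S' : tm.K → List (Symb tm)} {S : ∀ k, List (tm.Γ k)}
    (h : Represents S' S) {k : tm.K} {g : Symb tm} {x : tm.Γ k} (hg : decode k g = some x) :
    Represents (Function.update S' k (g :: S' k)) (Function.update S k (x :: S k)) := by
  intro k'
  by_cases hk : k' = k
  · subst hk
    simp [h k', hg]
  · simp [hk, h k']

variable (e : tm.Γ tm.k₁ ≃ Bool)

/-- One step of `tm` is simulated instruction by instruction, within bounds that leave room for one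
symbol per instruction. -/
theorem exists_reach_stepAux {B : ℕ} (q : TM2.Stmt tm.Γ tm.Λ tm.σ)
    (hq : ∃ l, q ∈ TM2.stmts₁ (tm.m l)) (v : tm.σ) (S : ∀ k, List (tm.Γ k))
    (S' : tm.K → List (Symb tm)) (hS : Represents S' S)
    (hB : ∀ k, (S k).length + size q < B) :
    ∃ c S'', Represents S'' (TM2.stepAux q v S).stk ∧ Control c (TM2.stepAux q v S) ∧
      Relation.ReflTransGen ((machine tm e).BStep B) (.inl (⟨q, hq⟩, v), S') (c, S'') := by
  have hB' : ∀ k, (S' k).length < B := fun k => by rw [hS.length]; have := hB k; omega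
  induction q generalizing v S S' with
  | push k f q ih =>
    obtain ⟨c, S'', h1, h2, h3⟩ := ih (exists_mem_stmts₁_of_mem
      (by simp [TM2.stmts₁, TM2.stmts₁_self]) hq) v _ _ (hS.push (k := k) (x := f v)
        (g := .inl (⟨.push k f q, hq⟩, v)) (by simp [decode])) (fun k' => by
          have := hB k'
          simp only [size] at this
          by_cases hk : k' = k
          · subst hk; simp; omega
          · simp [hk]; omega) (fun k' => by
          have := hB k'
          have h' := hS.length k'
          simp only [size] at this
          by_cases hk : k' = k
          · subst hk
            rw [Function.update_self]
            change (S' k').length + 1 < B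
            omega
          · simp [hk]; omega)
    exact ⟨c, S'', h1, h2, .head ⟨hB' k, rfl⟩ h3⟩
  | peek k f q ih =>
    obtain ⟨c, S'', h1, h2, h3⟩ := ih (exists_mem_stmts₁_of_mem
      (by simp [TM2.stmts₁, TM2.stmts₁_self]) hq) (f v (S k).head?) S S' hS
        (fun k' => by have := hB k'; simp only [size] at this; omega) hB'
    refine ⟨c, S'', h1, h2, .head ⟨hB' k, ?_⟩ h3⟩
    rw [← hS.head]
    exact Prod.ext rfl (Function.update_eq_self _ _).symm
  | pop k f q ih =>
    obtain ⟨c, S'', h1, h2, h3⟩ := ih (exists_mem_stmts₁_of_mem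
      (by simp [TM2.stmts₁, TM2.stmts₁_self]) hq) (f v (S k).head?) _ _ (hS.tail k)
        (fun k' => by
          have := hB k'
          simp only [size] at this
          by_cases hk : k' = k
          · subst hk; simp; omega
          · simp [hk]; omega) (fun k' => by
          have := hB' k'
          by_cases hk : k' = k
          · subst hk; simp; omega
          · simp [hk]; omega)
    refine ⟨c, S'', h1, h2, .head ⟨hB' k, ?_⟩ h3⟩
    rw [← hS.head]
    rfl
  | load f q ih =>
    obtain ⟨c, S'', h1, h2, h3⟩ := ih (exists_mem_stmts₁_of_mem
      (by simp [TM2.stmts₁, TM2.stmts₁_self]) hq) (f v) S S' hS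
        (fun k' => by have := hB k'; simp only [size] at this; omega) hB'
    refine ⟨c, S'', h1, h2, .head ⟨hB' _, ?_⟩ h3⟩
    exact Prod.ext rfl (Function.update_eq_self _ _).symm
  | branch f q₁ q₂ ih₁ ih₂ =>
    rw [TM2.stepAux]
    cases hf : f v with
    | true =>
      obtain ⟨c, S'', h1, h2, h3⟩ := ih₁ (exists_mem_stmts₁_of_mem
        (by simp [TM2.stmts₁, TM2.stmts₁_self]) hq) v S S' hS
          (fun k' => by have := hB k'; simp only [size] at this; omega) hB'
      refine ⟨c, S'', h1, h2, .head ⟨hB' _, ?_⟩ h3⟩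
      refine Prod.ext ?_ (Function.update_eq_self _ _).symm
      change _ = Sum.inl (bif f v then _ else _, v)
      rw [hf]
      rfl
    | false =>
      obtain ⟨c, S'', h1, h2, h3⟩ := ih₂ (exists_mem_stmts₁_of_mem
        (by simp [TM2.stmts₁, TM2.stmts₁_self]) hq) v S S' hS
          (fun k' => by have := hB k'; simp only [size] at this; omega) hB'
      refine ⟨c, S'', h1, h2, .head ⟨hB' _, ?_⟩ h3⟩
      refine Prod.ext ?_ (Function.update_eq_self _ _).symm
      change _ = Sum.inl (bif f v then _ else _, v)
      rw [hf]
      rfl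
  | goto f =>
    refine ⟨_, S', hS, rfl, .single ⟨hB' _, ?_⟩⟩
    exact Prod.ext rfl (Function.update_eq_self _ _).symm
  | halt => exact ⟨_, S', hS, ⟨hq, rfl⟩, .refl⟩

/-- The stacks representing the input `l`. -/
def inputStacks (l : List (tm.Γ tm.k₀)) : tm.K → List (Symb tm) :=
  fun k => if k = tm.k₀ then l.map .inr else []

theorem represents_inputStacks (l : List (tm.Γ tm.k₀)) :
    Represents (inputStacks l) (initList tm l).stk := by
  intro k
  by_cases hk : k = tm.k₀
  · subst hk
    simp only [inputStacks, initList, if_true, dite_true]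
    refine (List.map_map (l := l)).trans (List.map_congr_left fun x _ => ?_)
    exact dif_pos rfl
  · simp [inputStacks, initList, hk]

theorem exists_size_le (tm : FinTM2) : ∃ D, ∀ l, size (tm.m l) ≤ D := by
  have := tm.ΛFin
  exact ⟨Finset.univ.sup fun l => size (tm.m l), fun l =>
    Finset.le_sup (f := fun l => size (tm.m l)) (Finset.mem_univ l)⟩

theorem exists_reach_of_reaches {l : List (tm.Γ tm.k₀)} {s D B : ℕ}
    (hD : ∀ l, size (tm.m l) ≤ D) (hB : s + D < B)
    (hs : ∀ c : tm.Cfg, StateTransition.Reaches tm.step (initList tm l) c →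
      ∀ k, (TM2.Cfg.stk c k).length ≤ s)
    {cfg : tm.Cfg} (h : StateTransition.Reaches tm.step (initList tm l) cfg) :
    ∃ c S', Represents S' (TM2.Cfg.stk cfg) ∧ Control c cfg ∧
      Relation.ReflTransGen ((machine tm e).BStep B)
        ((machine tm e).init, inputStacks l) (c, S') := by
  induction h with
  | refl => exact ⟨_, _, represents_inputStacks l, rfl, .refl⟩
  | @tail cfg cfg' hcfg hstep ih =>
    obtain ⟨c, S', h1, h2, h3⟩ := ih
    obtain ⟨lab, v, S⟩ := cfg
    cases lab with
    | none => cases hstep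
    | some lab =>
      obtain rfl : TM2.stepAux (tm.m lab) v S = cfg' := Option.some.inj hstep
      have h2 : c = _ := h2
      subst h2
      obtain ⟨c', S'', h4, h5, h6⟩ := exists_reach_stepAux e (B := B) (tm.m lab)
        ⟨lab, TM2.stmts₁_self⟩ v S S' h1 fun k => by
          have h7 : (S k).length ≤ s := hs _ hcfg k
          have h8 := hD lab
          omega
      exact ⟨c', S'', h4, h5, h3.trans h6⟩

theorem reaches_of_evalsTo {σ : Type*} {f : σ → Option σ} {a b : σ}
    (h : StateTransition.EvalsTo f a (some b)) : StateTransition.Reaches f a b := by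
  obtain ⟨n, h⟩ := h
  have hnone : ∀ n, (flip Option.bind f)^[n] none = none := by
    intro n
    induction n with
    | zero => rfl
    | succ n ih => exact ih
  induction n generalizing a with
  | zero =>
    obtain rfl : a = b := Option.some.inj h
    exact .refl
  | succ n ih =>
    rw [Function.iterate_succ_apply] at h
    cases hf : f a with
    | none =>
      have : (flip Option.bind f)^[n] (f a) = some b := h
      rw [hf, hnone] at this
      cases this
    | some a' => exact .head hf (ih (by rw [← hf]; exact h))

theorem eq_of_reach_inr {B : ℕ} {b : Bool} {S : tm.K → List (Symb tm)}
    {s : Ctl tm × (tm.K → List (Symb tm))}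
    (h : Relation.ReflTransGen ((machine tm e).BStep B) (.inr b, S) s) : s.1 = .inr b := by
  induction h with
  | refl => rfl
  | @tail s s' _ h ih =>
    obtain ⟨c, S'⟩ := s
    obtain rfl : c = .inr b := ih
    obtain ⟨-, rfl⟩ := h
    rfl

/-- A machine deciding whether `b = true`, with bounded stacks, is correctly simulated. -/
theorem reach_accepts_iff {l : List (tm.Γ tm.k₀)} {s D B : ℕ} {b : Bool}
    (hD : ∀ l, size (tm.m l) ≤ D) (hB : s + D < B)
    (hs : ∀ c : tm.Cfg, StateTransition.Reaches tm.step (initList tm l) c →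
      ∀ k, (TM2.Cfg.stk c k).length ≤ s)
    (h : TM2Outputs tm l (some [e.symm b])) :
    (∃ s, Relation.ReflTransGen ((machine tm e).BStep B)
      ((machine tm e).init, inputStacks l) s ∧ (machine tm e).accepts s.1) ↔ b = true := by
  have hr : StateTransition.Reaches tm.step (initList tm l) (haltList tm [e.symm b]) :=
    reaches_of_evalsTo h
  obtain ⟨c, S', h1, ⟨hq, rfl⟩, h3⟩ := exists_reach_of_reaches e hD hB hs hr
  have hhead : (S' tm.k₁).head?.bind (decode tm.k₁) = some (e.symm b) := by
    rw [h1.head]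
    simp [haltList]
  have hfin : Relation.ReflTransGen ((machine tm e).BStep B)
      ((machine tm e).init, inputStacks l) (.inr b, S') := by
    refine h3.tail ⟨?_, ?_⟩
    · change (S' tm.k₁).length < B
      rw [h1.length]
      have := hs _ hr tm.k₁
      omega
    · refine Prod.ext ?_ (Function.update_eq_self _ _).symm
      change _ = Sum.inr ((((S' tm.k₁).head?.bind (decode tm.k₁)).map e).getD false)
      simp [hhead]
  constructor
  · rintro ⟨⟨c, S''⟩, hs, hacc⟩
    rcases Relation.ReflTransGen.total_of_right_unique
      (fun x y z hxy hxz => hxy.2.trans hxz.2.symm) hfin hs with h | h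
    · obtain rfl : c = .inr b := eq_of_reach_inr e h
      exact hacc
    · cases c with
      | inl _ => cases hacc
      | inr b' =>
        have : Sum.inr b = Sum.inr b' := eq_of_reach_inr e h
        cases this
        exact hacc
  · rintro rfl
    exact ⟨_, hfin, rfl⟩

end TM2Sim

/-! ### A small programming language compiled to multi-stack Turing machines -/

/-- Programs on stacks: doing nothing, pushing a symbol, and a loop popping a stack until it is empty and
running a program that may depend on the popped symbol. -/
inductive Prog {K : Type} (Γ : K → Type) : Type
  | skip
  | push (k : K) (g : Γ k)
  | seq (p q : Prog Γ)
  | loop (k : K) (body : Γ k → Prog Γ)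

namespace Prog

open Turing

variable {K : Type} {Γ : K → Type}

/-- The labels of the compiled program. -/
def Label : Prog Γ → Type
  | skip => Unit
  | push _ _ => Unit
  | seq p q => Label p ⊕ Label q
  | loop _ body => Option (Σ g, Label (body g))

/-- The label at which the compiled program starts. -/
def entry : (p : Prog Γ) → Label p
  | skip => ()
  | push _ _ => ()
  | seq p _ => .inl (entry p)
  | loop _ _ => none

theorem finite_label [∀ k, Finite (Γ k)] (p : Prog Γ) : Finite (Label p) := by
  induction p with
  | skip => exact inferInstanceAs (Finite Unit)
  | push k g => exact inferInstanceAs (Finite Unit)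
  | seq p q hp hq => exact inferInstanceAs (Finite (Label p ⊕ Label q))
  | loop k body ih => exact inferInstanceAs (Finite (Option (Σ g, Label (body g))))

/-- The internal state of the compiled program: the symbol popped last. -/
abbrev Popped (Γ : K → Type) : Type :=
  Option (Σ k, Γ k)

variable [DecidableEq K]

/-- The compiled program, with labels embedded by `ι` and continuing at `exit`. -/
def compile {Λ : Type} : (p : Prog Γ) → (Label p → Λ) → Λ → Label p → TM2.Stmt Γ Λ (Popped Γ)
  | skip, _, exit, _ => .goto fun _ => exit
  | push k g, _, exit, _ => .push k (fun _ => g) (.goto fun _ => exit)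
  | seq p q, ι, _, .inl l => compile p (fun l => ι (.inl l)) (ι (.inr (entry q))) l
  | seq _ q, ι, exit, .inr l => compile q (fun l => ι (.inr l)) exit l
  | loop k body, ι, exit, none => .pop k (fun _ x => x.map (Sigma.mk k)) (.goto fun v =>
      match v with
      | none => exit
      | some ⟨k', g⟩ => if h : k' = k then ι (some ⟨h ▸ g, entry (body (h ▸ g))⟩) else exit)
  | loop _ body, ι, _, some ⟨g, l⟩ => compile (body g) (fun l => ι (some ⟨g, l⟩)) (ι none) l

/-- `Exec p S S' t`: the program `p` transforms the stacks `S` into `S'` in `t` steps. -/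
inductive Exec : Prog Γ → (∀ k, List (Γ k)) → (∀ k, List (Γ k)) → ℕ → Prop
  | skip (S : ∀ k, List (Γ k)) : Exec skip S S 1
  | push (k : K) (g : Γ k) (S : ∀ k, List (Γ k)) :
      Exec (push k g) S (Function.update S k (g :: S k)) 1
  | seq {p q : Prog Γ} {S S' S'' : ∀ k, List (Γ k)} {t t' : ℕ} (h : Exec p S S' t)
      (h' : Exec q S' S'' t') : Exec (seq p q) S S'' (t + t')
  | loop_nil {k : K} (body : Γ k → Prog Γ) {S : ∀ k, List (Γ k)} (h : S k = []) :
      Exec (loop k body) S S 1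
  | loop_cons {k : K} {body : Γ k → Prog Γ} {S S' S'' : ∀ k, List (Γ k)} {g : Γ k}
      {l : List (Γ k)} {t t' : ℕ} (h : S k = g :: l)
      (hb : Exec (body g) (Function.update S k l) S' t) (h' : Exec (loop k body) S' S'' t') :
      Exec (loop k body) S S'' (1 + t + t')

/-- A compiled program runs as described by `Exec`, whatever machine it is a part of. -/
theorem Exec.iterate_step {p : Prog Γ} {S S' : ∀ k, List (Γ k)} {t : ℕ} (h : Exec p S S' t)
    {Λ : Type} (m : Λ → TM2.Stmt Γ Λ (Popped Γ)) (ι : Label p → Λ) (exit : Λ)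
    (hm : ∀ l, m (ι l) = compile p ι exit l) (v : Popped Γ) :
    ∃ v', (flip Option.bind (TM2.step m))^[t] (some ⟨some (ι (entry p)), v, S⟩) =
      some ⟨some exit, v', S'⟩ := by
  induction h generalizing v exit with
  | skip S => exact ⟨v, by simp [flip, hm, compile]⟩
  | push k g S => exact ⟨v, by simp [flip, hm, compile]⟩
  | @seq p q S S' S'' t t' _ _ ih ih' =>
    obtain ⟨v', h1⟩ := ih (fun l => ι (.inl l)) (ι (.inr (entry q))) (fun l => hm (.inl l)) v
    obtain ⟨v'', h2⟩ := ih' (fun l => ι (.inr l)) exit (fun l => hm (.inr l)) v'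
    refine ⟨v'', ?_⟩
    rw [add_comm, Function.iterate_add_apply]
    exact (congrArg _ h1).trans h2
  | @loop_nil k body S h =>
    have h0 : m (ι none) = _ := hm none
    rw [compile] at h0
    have h1 : Function.update S k [] = S := by rw [← h, Function.update_eq_self]
    exact ⟨none, by simp [flip, entry, h0, h, h1]⟩
  | @loop_cons k body S S' S'' g l t t' h _ _ ih ih' =>
    obtain ⟨v', h1⟩ := ih (fun l => ι (some ⟨g, l⟩)) (ι none) (fun l => hm (some ⟨g, l⟩))
      (some ⟨k, g⟩)
    obtain ⟨v'', h2⟩ := ih' ι exit hm v'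
    refine ⟨v'', ?_⟩
    rw [add_comm, Function.iterate_add_apply, add_comm 1 t, Function.iterate_add_apply]
    refine (congrArg _ (Eq.trans (congrArg _ ?_) h1)).trans h2
    have h0 : m (ι none) = _ := hm none
    rw [compile] at h0
    simp [flip, entry, h0, h]

/-- The machine running a program. -/
noncomputable def machine [Fintype K] [∀ k, Finite (Γ k)] (k₀ k₁ : K) (p : Prog Γ) : FinTM2 where
  K := K
  k₀ := k₀
  k₁ := k₁
  Γ := Γ
  Λ := Option (Label p)
  main := some (entry p)
  ΛFin := by
    have := finite_label p
    exact Fintype.ofFinite _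
  σ := Popped Γ
  initialState := none
  σFin := Fintype.ofFinite _
  Γk₀Fin := Fintype.ofFinite _
  m l := match l with
    | none => .load (fun _ => none) .halt
    | some l => compile p some none l

theorem initList_eq (tm : FinTM2) (l : List (tm.Γ tm.k₀)) :
    initList tm l = ⟨some tm.main, tm.initialState, Function.update (fun _ => []) tm.k₀ l⟩ := by
  refine congrArg (TM2.Cfg.mk _ _) (funext fun k => ?_)
  by_cases hk : k = tm.k₀
  · subst hk
    simp
  · simp [hk]

theorem haltList_eq (tm : FinTM2) (l : List (tm.Γ tm.k₁)) :
    haltList tm l = ⟨none, tm.initialState, Function.update (fun _ => []) tm.k₁ l⟩ := by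
  refine congrArg (TM2.Cfg.mk _ _) (funext fun k => ?_)
  by_cases hk : k = tm.k₁
  · subst hk
    simp
  · simp [hk]

/-- A function computed by a program, in a number of steps bounded by a polynomial, is computable in
polynomial time. -/
theorem nonempty_computableInPolyTime [Fintype K] [∀ k, Finite (Γ k)] {k₀ k₁ : K} (p : Prog Γ)
    {β : Type} (enc : β → List (Γ k₁)) (f : List (Γ k₀) → β) (T : Polynomial ℕ)
    (h : ∀ w, ∃ t ≤ T.eval w.length,
      Exec p (Function.update (fun _ => []) k₀ w) (Function.update (fun _ => []) k₁ (enc (f w))) t) :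
    Nonempty (TM2ComputableInPolyTime (id : List (Γ k₀) → List (Γ k₀)) enc f) := by
  have key : ∀ w : List (Γ k₀), ∃ t ≤ (T + 1).eval w.length,
      (flip Option.bind (machine k₀ k₁ p).step)^[t] (some (initList (machine k₀ k₁ p) w)) =
        some (haltList (machine k₀ k₁ p) (enc (f w))) := by
    intro w
    obtain ⟨t, ht, h⟩ := h w
    refine ⟨1 + t, by simp only [Polynomial.eval_add, Polynomial.eval_one]; omega, ?_⟩
    obtain ⟨v', h⟩ := h.iterate_step (machine k₀ k₁ p).m some none (fun _ => rfl) none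
    rw [Function.iterate_add_apply]
    refine Eq.trans ?_ (congrArg some (haltList_eq (machine k₀ k₁ p) (enc (f w))).symm)
    refine (congrArg (fun c => _^[1] (_^[t] (some c))) (initList_eq (machine k₀ k₁ p) w)).trans ?_
    exact (congrArg _ h).trans rfl
  exact ⟨{
    tm := machine k₀ k₁ p
    inputAlphabet := Equiv.refl _
    outputAlphabet := Equiv.refl _
    time := T + 1
    outputsFun := fun w => {
      steps := (key w).choose
      evals_in_steps := by
        have h0 : List.map (id : Γ k₀ → Γ k₀) w = w := List.map_id w
        have h1 : List.map (id : Γ k₁ → Γ k₁) (enc (f w)) = enc (f w) := List.map_id _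
        exact (congrArg (fun l => _^[_] (some (initList (machine k₀ k₁ p) l))) h0).trans
          ((key w).choose_spec.2.trans
            (congrArg (fun l => some (haltList (machine k₀ k₁ p) l)) h1.symm))
      steps_le_m := (key w).choose_spec.1 } }⟩

end Prog

/-! ### Generating words of polynomial length -/

namespace Generator

open RCInstance (Sym encodeNat)

/-- The stacks used by the generating programs: the input `inp`, the output `out`, the reversed
input `rev`, and the unary counters `cnt` (the length of the input), `acc` (the value of a
polynomial), `idx` (a loop index), `tmp` and `scr`. -/
inductive Reg : Type
  | inp
  | rev
  | cnt
  | acc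
  | tmp
  | scr
  | idx
  | out
  deriving DecidableEq

instance : Fintype Reg where
  elems := {.inp, .rev, .cnt, .acc, .tmp, .scr, .idx, .out}
  complete x := by cases x <;> simp

/-- The stack alphabets. -/
abbrev Alph (α : Type) : Reg → Type
  | .inp => α
  | .rev => α
  | .out => Sym
  | _ => Unit

instance {α : Type} [Finite α] (k : Reg) : Finite (Alph α k) := by
  cases k <;> simp only [Alph] <;> infer_instance

variable {α : Type}

/-- The contents of all the stacks, with counters as numbers. -/
structure Mem (α : Type) where
  inp : List α
  rev : List α
  cnt : ℕ
  acc : ℕ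
  tmp : ℕ
  scr : ℕ
  idx : ℕ
  out : List Sym

/-- The stacks holding the given contents. -/
def Mem.stacks (m : Mem α) : ∀ k, List (Alph α k)
  | .inp => m.inp
  | .rev => m.rev
  | .cnt => List.replicate m.cnt ()
  | .acc => List.replicate m.acc ()
  | .tmp => List.replicate m.tmp ()
  | .scr => List.replicate m.scr ()
  | .idx => List.replicate m.idx ()
  | .out => m.out

/-- The program `p` transforms `m` into `m'` in at most `T` steps. -/
def Runs (p : Prog (Alph α)) (m m' : Mem α) (T : ℕ) : Prop :=
  ∃ t ≤ T, p.Exec m.stacks m'.stacks t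

/-- `m'` results from `m` by pushing `g` on the stack `k`. -/
def Pushed (k : Reg) (g : Alph α k) (m m' : Mem α) : Prop :=
  m'.stacks = Function.update m.stacks k (g :: m.stacks k)

theorem Runs.mono {p : Prog (Alph α)} {m m' : Mem α} {T T' : ℕ} (h : Runs p m m' T)
    (hT : T ≤ T') : Runs p m m' T' := by
  obtain ⟨t, ht, h⟩ := h
  exact ⟨t, ht.trans hT, h⟩

theorem runs_skip (m : Mem α) : Runs .skip m m 1 :=
  ⟨1, le_rfl, .skip _⟩

theorem Pushed.runs {k : Reg} {g : Alph α k} {m m' : Mem α} (h : Pushed k g m m') :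
    Runs (.push k g) m m' 1 :=
  ⟨1, le_rfl, by rw [h]; exact .push _ _ _⟩

theorem Runs.seq {p q : Prog (Alph α)} {m m' m'' : Mem α} {T T' : ℕ} (h : Runs p m m' T)
    (h' : Runs q m' m'' T') : Runs (.seq p q) m m'' (T + T') := by
  obtain ⟨t, ht, h⟩ := h
  obtain ⟨t', ht', h'⟩ := h'
  exact ⟨t + t', by omega, h.seq h'⟩

theorem runs_loop_nil {k : Reg} (body : Alph α k → Prog (Alph α)) {m : Mem α}
    (h : m.stacks k = []) : Runs (.loop k body) m m 1 :=
  ⟨1, le_rfl, .loop_nil _ h⟩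

theorem Pushed.runs_loop {k : Reg} {body : Alph α k → Prog (Alph α)} {m m₁ m₂ m₃ : Mem α}
    {g : Alph α k} {T T' : ℕ} (h : Pushed k g m₁ m) (hb : Runs (body g) m₁ m₂ T)
    (h' : Runs (.loop k body) m₂ m₃ T') : Runs (.loop k body) m m₃ (1 + T + T') := by
  obtain ⟨t, ht, hb⟩ := hb
  obtain ⟨t', ht', h'⟩ := h'
  exact ⟨1 + t + t', by omega, .loop_cons (g := g) (l := m₁.stacks k) (by rw [h]; simp)
    (by rw [h]; simpa using hb) h'⟩

section Pushes

variable (i r : List α) (c a t s x : ℕ) (o : List Sym)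

theorem pushed_inp (g : α) : Pushed .inp g ⟨i, r, c, a, t, s, x, o⟩ ⟨g :: i, r, c, a, t, s, x, o⟩ := by
  funext k; cases k <;> simp [Mem.stacks]

theorem pushed_rev (g : α) : Pushed .rev g ⟨i, r, c, a, t, s, x, o⟩ ⟨i, g :: r, c, a, t, s, x, o⟩ := by
  funext k; cases k <;> simp [Mem.stacks]

theorem pushed_cnt : Pushed .cnt () ⟨i, r, c, a, t, s, x, o⟩ ⟨i, r, c + 1, a, t, s, x, o⟩ := by
  funext k; cases k <;> simp [Mem.stacks, List.replicate_succ]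

theorem pushed_acc : Pushed .acc () ⟨i, r, c, a, t, s, x, o⟩ ⟨i, r, c, a + 1, t, s, x, o⟩ := by
  funext k; cases k <;> simp [Mem.stacks, List.replicate_succ]

theorem pushed_tmp : Pushed .tmp () ⟨i, r, c, a, t, s, x, o⟩ ⟨i, r, c, a, t + 1, s, x, o⟩ := by
  funext k; cases k <;> simp [Mem.stacks, List.replicate_succ]

theorem pushed_scr : Pushed .scr () ⟨i, r, c, a, t, s, x, o⟩ ⟨i, r, c, a, t, s + 1, x, o⟩ := by
  funext k; cases k <;> simp [Mem.stacks, List.replicate_succ]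

theorem pushed_idx : Pushed .idx () ⟨i, r, c, a, t, s, x, o⟩ ⟨i, r, c, a, t, s, x + 1, o⟩ := by
  funext k; cases k <;> simp [Mem.stacks, List.replicate_succ]

theorem pushed_out (g : Sym) :
    Pushed .out g ⟨i, r, c, a, t, s, x, o⟩ ⟨i, r, c, a, t, s, x, g :: o⟩ := by
  funext k; cases k <;> simp [Mem.stacks]

end Pushes

/-! ### Words depending on an index -/

/-- A part of a word depending on an index `j`: the encoding of the number `a * j + b`, or a
symbol. -/
inductive Item : Type
  | num (a b : ℕ)
  | sym (s : Sym)

/-- The word described by an item. -/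
def Item.eval (j : ℕ) : Item → List Sym
  | num a b => encodeNat (a * j + b)
  | sym s => [s]

/-- The running time of the program for an item is at most its weight times `j + 1`. -/
def Item.weight : Item → ℕ
  | num a b => a + b + 5
  | sym _ => 1

/-- The program writing `b` ticks. -/
def ticks : ℕ → Prog (Alph α)
  | 0 => .skip
  | b + 1 => .seq (.push .out .tick) (ticks b)

/-- The program writing an item in front of the output. -/
def Item.prog : Item → Prog (Alph α)
  | num a b => .seq (.push .out .comma)
      (.seq (.loop .idx fun _ => .seq (.push .scr ()) (ticks a))
        (.seq (.loop .scr fun _ => .push .idx ()) (ticks b)))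
  | sym s => .push .out s

/-- The word described by a list of items. -/
def word (l : List Item) (j : ℕ) : List Sym :=
  l.flatMap (Item.eval j)

/-- The program writing a word in front of the output. -/
def emit : List Item → Prog (Alph α)
  | [] => .skip
  | x :: l => .seq (emit l) x.prog

/-- The running time of `emit l` is at most its weight times `j + 1`. -/
def weight (l : List Item) : ℕ :=
  (l.map Item.weight).sum + 1

section

variable (i r : List α) (c a t : ℕ)

theorem runs_ticks (s x b : ℕ) (o : List Sym) :
    Runs (ticks b) ⟨i, r, c, a, t, s, x, o⟩
      ⟨i, r, c, a, t, s, x, List.replicate b .tick ++ o⟩ (b + 1) := by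
  induction b generalizing o with
  | zero => exact runs_skip _
  | succ b ih =>
    have := (pushed_out i r c a t s x o .tick).runs.seq (ih (.tick :: o))
    rw [List.replicate_succ', List.append_assoc]
    exact this.mono (by omega)

theorem runs_loop_idx_ticks (b s x : ℕ) (o : List Sym) :
    Runs (.loop .idx fun _ => .seq (.push .scr ()) (ticks b)) ⟨i, r, c, a, t, s, x, o⟩
      ⟨i, r, c, a, t, s + x, 0, List.replicate (b * x) .tick ++ o⟩ (x * (b + 3) + 1) := by
  induction x generalizing s o with
  | zero => exact (runs_loop_nil (m := ⟨i, r, c, a, t, s, 0, o⟩) _ rfl).mono (by omega)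
  | succ x ih =>
    have h1 := (pushed_scr i r c a t s x o).runs.seq (runs_ticks i r c a t (s + 1) x b o)
    have := (pushed_idx i r c a t s x o).runs_loop
      (body := fun _ => .seq (.push .scr ()) (ticks b)) h1 (ih _ _)
    rw [← List.append_assoc, List.replicate_append_replicate, show s + 1 + x = s + (x + 1) by omega,
      show b * x + b = b * (x + 1) by ring] at this
    exact this.mono (by ring_nf; omega)

theorem runs_loop_scr_idx (s x : ℕ) (o : List Sym) :
    Runs (.loop .scr fun _ => .push .idx ()) ⟨i, r, c, a, t, s, x, o⟩
      ⟨i, r, c, a, t, 0, x + s, o⟩ (s * 2 + 1) := by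
  induction s generalizing x with
  | zero => exact runs_loop_nil _ rfl
  | succ s ih =>
    have := (pushed_scr i r c a t s x o).runs_loop (body := fun _ => .push .idx ())
      (pushed_idx i r c a t s x o).runs (ih _)
    rw [show x + 1 + s = x + (s + 1) by omega] at this
    exact this.mono (by omega)

theorem runs_item (y : Item) (x : ℕ) (o : List Sym) :
    Runs y.prog ⟨i, r, c, a, t, 0, x, o⟩ ⟨i, r, c, a, t, 0, x, y.eval x ++ o⟩
      (y.weight * (x + 1)) := by
  cases y with
  | num p q =>
    have h1 := runs_loop_idx_ticks i r c a t p 0 x (.comma :: o)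
    have h2 := runs_loop_scr_idx i r c a t (0 + x) 0 (List.replicate (p * x) .tick ++ .comma :: o)
    have h3 := runs_ticks i r c a t 0 (0 + (0 + x)) q
      (List.replicate (p * x) .tick ++ .comma :: o)
    have := (pushed_out i r c a t 0 x o .comma).runs.seq (h1.seq (h2.seq h3))
    simp only [zero_add] at this
    have he : Item.eval x (.num p q) ++ o =
        List.replicate q .tick ++ (List.replicate (p * x) .tick ++ .comma :: o) := by
      rw [← List.append_assoc, List.replicate_append_replicate, add_comm q]
      simp [Item.eval, encodeNat]
    rw [he]
    refine this.mono ?_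
    simp only [Item.weight]
    nlinarith
  | sym g => exact (pushed_out i r c a t 0 x o g).runs.mono (by simp [Item.weight])

theorem runs_emit (l : List Item) (x : ℕ) (o : List Sym) :
    Runs (emit l) ⟨i, r, c, a, t, 0, x, o⟩ ⟨i, r, c, a, t, 0, x, word l x ++ o⟩
      (weight l * (x + 1)) := by
  induction l with
  | nil => exact (runs_skip _).mono (by simp [weight])
  | cons y l ih =>
    have := ih.seq (runs_item i r c a t y x (word l x ++ o))
    rw [← List.append_assoc] at this
    refine this.mono ?_
    simp only [weight, List.map_cons, List.sum_cons]
    exact le_of_eq (by ring)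

end

/-! ### Polynomials in unary -/

/-- The program adding `b` to `acc`. -/
def addConst : ℕ → Prog (Alph α)
  | 0 => .skip
  | b + 1 => .seq (.push .acc ()) (addConst b)

/-- The program multiplying `acc` by `cnt`. -/
def mulCnt : Prog (Alph α) :=
  .seq (.loop .acc fun _ => .push .tmp ())
    (.loop .tmp fun _ => .seq (.loop .cnt fun _ => .seq (.push .scr ()) (.push .acc ()))
      (.loop .scr fun _ => .push .cnt ()))

section

variable (i r : List α)

theorem runs_addConst (b c a t s x : ℕ) (o : List Sym) :
    Runs (addConst b) ⟨i, r, c, a, t, s, x, o⟩ ⟨i, r, c, a + b, t, s, x, o⟩ (b + 1) := by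
  induction b generalizing a with
  | zero => exact runs_skip _
  | succ b ih =>
    have := (pushed_acc i r c a t s x o).runs.seq (ih (a + 1))
    rw [show a + 1 + b = a + (b + 1) by omega] at this
    exact this.mono (by omega)

theorem runs_loop_acc_tmp (c a t s x : ℕ) (o : List Sym) :
    Runs (.loop .acc fun _ => .push .tmp ()) ⟨i, r, c, a, t, s, x, o⟩
      ⟨i, r, c, 0, t + a, s, x, o⟩ (a * 2 + 1) := by
  induction a generalizing t with
  | zero => exact runs_loop_nil _ rfl
  | succ a ih =>
    have := (pushed_acc i r c a t s x o).runs_loop (body := fun _ => .push .tmp ())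
      (pushed_tmp i r c a t s x o).runs (ih _)
    rw [show t + 1 + a = t + (a + 1) by omega] at this
    exact this.mono (by omega)

theorem runs_loop_cnt (c a t s x : ℕ) (o : List Sym) :
    Runs (.loop .cnt fun _ => .seq (.push .scr ()) (.push .acc ())) ⟨i, r, c, a, t, s, x, o⟩
      ⟨i, r, 0, a + c, t, s + c, x, o⟩ (c * 3 + 1) := by
  induction c generalizing a s with
  | zero => exact runs_loop_nil _ rfl
  | succ c ih =>
    have := (pushed_cnt i r c a t s x o).runs_loop
      (body := fun _ => .seq (.push .scr ()) (.push .acc ()))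
      ((pushed_scr i r c a t s x o).runs.seq (pushed_acc i r c a t (s + 1) x o).runs) (ih _ _)
    rw [show a + 1 + c = a + (c + 1) by omega, show s + 1 + c = s + (c + 1) by omega] at this
    exact this.mono (by omega)

theorem runs_loop_scr_cnt (c a t s x : ℕ) (o : List Sym) :
    Runs (.loop .scr fun _ => .push .cnt ()) ⟨i, r, c, a, t, s, x, o⟩
      ⟨i, r, c + s, a, t, 0, x, o⟩ (s * 2 + 1) := by
  induction s generalizing c with
  | zero => exact runs_loop_nil _ rfl
  | succ s ih =>
    have := (pushed_scr i r c a t s x o).runs_loop (body := fun _ => .push .cnt ())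
      (pushed_cnt i r c a t s x o).runs (ih _)
    rw [show c + 1 + s = c + (s + 1) by omega] at this
    exact this.mono (by omega)

theorem runs_loop_tmp (c a t x : ℕ) (o : List Sym) :
    Runs (.loop .tmp fun _ => .seq (.loop .cnt fun _ => .seq (.push .scr ()) (.push .acc ()))
      (.loop .scr fun _ => .push .cnt ())) ⟨i, r, c, a, t, 0, x, o⟩
      ⟨i, r, c, a + t * c, 0, 0, x, o⟩ (t * (c * 5 + 3) + 1) := by
  induction t generalizing a with
  | zero =>
    simp only [zero_mul, add_zero, zero_add]
    exact runs_loop_nil _ rfl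
  | succ t ih =>
    have h1 := (runs_loop_cnt i r c a t 0 x o).seq (runs_loop_scr_cnt i r 0 (a + c) t (0 + c) x o)
    simp only [zero_add] at h1
    have := (pushed_tmp i r c a t 0 x o).runs_loop
      (body := fun _ => .seq (.loop .cnt fun _ => .seq (.push .scr ()) (.push .acc ()))
        (.loop .scr fun _ => .push .cnt ())) h1 (ih _)
    rw [show a + c + t * c = a + (t + 1) * c by ring] at this
    exact this.mono (by ring_nf; omega)

theorem runs_mulCnt (c a x : ℕ) (o : List Sym) :
    Runs mulCnt ⟨i, r, c, a, 0, 0, x, o⟩ ⟨i, r, c, a * c, 0, 0, x, o⟩ (a * (c * 5 + 5) + 2) := by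
  have := (runs_loop_acc_tmp i r c a 0 0 x o).seq (runs_loop_tmp i r c 0 (0 + a) x o)
  simp only [zero_add] at this
  exact this.mono (le_of_eq (by ring))

end

/-- Evaluating a polynomial at `cnt`, by Horner's rule. -/
theorem exists_prog_eval (p : Polynomial ℕ) : ∃ (P : Prog (Alph α)) (T : Polynomial ℕ),
    ∀ (i r : List α) (c x : ℕ) (o : List Sym),
      Runs P ⟨i, r, c, 0, 0, 0, x, o⟩ ⟨i, r, c, p.eval c, 0, 0, x, o⟩ (T.eval c) := by
  induction p using Polynomial.recOnHorner with
  | M0 => exact ⟨.skip, 1, fun i r c x o => by simpa using runs_skip _⟩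
  | MC p b _ _ ih =>
    obtain ⟨P, T, h⟩ := ih
    refine ⟨.seq P (addConst b), T + Polynomial.C (b + 1), fun i r c x o => ?_⟩
    simpa using (h i r c x o).seq (runs_addConst i r b c (p.eval c) 0 0 x o)
  | MX p _ ih =>
    obtain ⟨P, T, h⟩ := ih
    refine ⟨.seq P mulCnt, T + (p * (Polynomial.X * 5 + 5) + 2), fun i r c x o => ?_⟩
    simpa using (h i r c x o).seq (runs_mulCnt i r c (p.eval c) x o)

/-! ### The generating program -/

/-- The words `word (b h) h` for `h < n`, the last one first, as they are pushed on a stack for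
increasing `h`. -/
def blocks (b : ℕ → List Item) (n : ℕ) : List Sym :=
  (List.range n).reverse.flatMap fun h => word (b h) h

theorem blocks_succ (b : ℕ → List Item) (n : ℕ) :
    blocks b (n + 1) = word (b n) n ++ blocks b n := by
  simp [blocks, List.range_succ]

section

variable (i : List α)

theorem runs_read (r : List α) (c a t s x : ℕ) (o : List Sym) :
    Runs (.loop .inp fun g => .seq (.push .rev g) (.push .cnt ())) ⟨i, r, c, a, t, s, x, o⟩
      ⟨[], i.reverse ++ r, c + i.length, a, t, s, x, o⟩ (i.length * 3 + 1) := by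
  induction i generalizing r c with
  | nil => exact runs_loop_nil _ rfl
  | cons g i ih =>
    have := (pushed_inp i r c a t s x o g).runs_loop (k := .inp)
      (body := fun g => .seq (.push .rev g) (.push .cnt ()))
      ((pushed_rev i r c a t s x o g).runs.seq (pushed_cnt i (g :: r) c a t s x o).runs) (ih _ _)
    rw [show c + 1 + i.length = c + (g :: i).length by simp; omega,
      show i.reverse ++ g :: r = (g :: i).reverse ++ r by simp] at this
    exact this.mono (by simp; omega)

theorem runs_loop_rev (sym : α → List Item) (W M : ℕ) (hW : ∀ g, weight (sym g) ≤ W)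
    (b : ℕ → List Item) (r : List α) (c a t x : ℕ) (o : List Sym) (hM : x + r.length ≤ M)
    (hb : ∀ j g, r[j]? = some g → b (x + j) = sym g) :
    Runs (.loop .rev fun g => .seq (emit (sym g)) (.push .idx ()))
      ⟨i, r, c, a, t, 0, x, blocks b x ++ o⟩
      ⟨i, [], c, a, t, 0, x + r.length, blocks b (x + r.length) ++ o⟩
      (r.length * (W * (M + 1) + 2) + 1) := by
  induction r generalizing x with
  | nil => exact (runs_loop_nil (m := ⟨i, [], c, a, t, 0, x, blocks b x ++ o⟩) _ rfl).mono (by omega)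
  | cons g r ih =>
    rw [List.length_cons] at hM
    have hg : b x = sym g := hb 0 g rfl
    have h1 := (runs_emit i r c a t (sym g) x (blocks b x ++ o)).seq (pushed_idx _ _ _ _ _ _ _ _).runs
    rw [← List.append_assoc, ← hg, ← blocks_succ, hg] at h1
    have := (pushed_rev i r c a t 0 x (blocks b x ++ o) g).runs_loop
      (body := fun g => .seq (emit (sym g)) (.push .idx ())) h1
      (ih (x + 1) (by omega) fun j g' hj => by
        rw [show x + 1 + j = x + (j + 1) by omega]
        exact hb (j + 1) g' hj)
    rw [show x + 1 + r.length = x + (g :: r).length by simp; omega] at this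
    refine this.mono ?_
    have := Nat.mul_le_mul (hW g) (show x + 1 ≤ M + 1 by omega)
    rw [List.length_cons, Nat.succ_mul]
    omega

theorem runs_loop_acc (blank : List Item) (M : ℕ) (b : ℕ → List Item) (r : List α)
    (c a t x : ℕ) (o : List Sym) (hM : x + a ≤ M) (hb : ∀ j ≥ x, b j = blank) :
    Runs (.loop .acc fun _ => .seq (emit blank) (.push .idx ()))
      ⟨i, r, c, a, t, 0, x, blocks b x ++ o⟩
      ⟨i, r, c, 0, t, 0, x + a, blocks b (x + a) ++ o⟩
      (a * (weight blank * (M + 1) + 2) + 1) := by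
  induction a generalizing x with
  | zero => exact (runs_loop_nil (m := ⟨i, r, c, 0, t, 0, x, blocks b x ++ o⟩) _ rfl).mono (by omega)
  | succ a ih =>
    have h1 := (runs_emit i r c a t blank x (blocks b x ++ o)).seq (pushed_idx _ _ _ _ _ _ _ _).runs
    rw [← List.append_assoc, ← hb x le_rfl, ← blocks_succ, hb x le_rfl] at h1
    have := (pushed_acc i r c a t 0 x (blocks b x ++ o)).runs_loop
      (body := fun _ => .seq (emit blank) (.push .idx ())) h1
      (ih (x + 1) (by omega) fun j hj => hb j (by omega))
    rw [show x + 1 + a = x + (a + 1) by omega] at this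
    refine this.mono ?_
    have := Nat.mul_le_mul_left (weight blank) (show x + 1 ≤ M + 1 by omega)
    rw [Nat.succ_mul]
    omega

theorem runs_clear_idx (r : List α) (c a t s x : ℕ) (o : List Sym) :
    Runs (.loop .idx fun _ => .skip) ⟨i, r, c, a, t, s, x, o⟩ ⟨i, r, c, a, t, s, 0, o⟩
      (x * 2 + 1) := by
  induction x with
  | zero => exact runs_loop_nil _ rfl
  | succ x ih =>
    exact ((pushed_idx i r c a t s x o).runs_loop (body := fun _ => .skip) (runs_skip _) ih).mono
      (by omega)

theorem runs_clear_cnt (r : List α) (c a t s x : ℕ) (o : List Sym) :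
    Runs (.loop .cnt fun _ => .skip) ⟨i, r, c, a, t, s, x, o⟩ ⟨i, r, 0, a, t, s, x, o⟩
      (c * 2 + 1) := by
  induction c with
  | zero => exact runs_loop_nil _ rfl
  | succ c ih =>
    exact ((pushed_cnt i r c a t s x o).runs_loop (body := fun _ => .skip) (runs_skip _) ih).mono
      (by omega)

end

/-- The block `h` for an input `w`: it depends on the letter number `h` of `w`, counted from the
end. -/
def block (sym : α → List Item) (blank : List Item) (w : List α) (h : ℕ) : List Item :=
  (w.reverse[h]?).elim blank sym

/-- Words consisting of a polynomial number of blocks, each of which is described by items, can be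
generated in polynomial time. -/
theorem nonempty_computableInPolyTime [Finite α] {β : Type} (enc : β → List Sym) (f : List α → β)
    (p : Polynomial ℕ) (sym : α → List Item) (blank pre post : List Item)
    (h : ∀ w, enc (f w) = word post (w.length + p.eval w.length) ++
      (blocks (block sym blank w) (w.length + p.eval w.length) ++ word pre 0)) :
    Nonempty (Turing.TM2ComputableInPolyTime (id : List α → List α) enc f) := by
  obtain ⟨P, T, hP⟩ := exists_prog_eval (α := α) p
  obtain ⟨W, hW⟩ : ∃ W, ∀ g, weight (sym g) ≤ W := by
    have := Fintype.ofFinite α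
    exact ⟨Finset.univ.sup fun g => weight (sym g), fun g =>
      Finset.le_sup (f := fun g => weight (sym g)) (Finset.mem_univ g)⟩
  refine Prog.nonempty_computableInPolyTime (Γ := Alph α) (k₀ := .inp) (k₁ := .out)
    (.seq (.loop .inp fun g => .seq (.push .rev g) (.push .cnt ()))
      (.seq P (.seq (emit pre)
        (.seq (.loop .rev fun g => .seq (emit (sym g)) (.push .idx ()))
          (.seq (.loop .acc fun _ => .seq (emit blank) (.push .idx ()))
            (.seq (emit post)
              (.seq (.loop .idx fun _ => .skip) (.loop .cnt fun _ => .skip))))))))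
    enc f
    ((.X * 3 + 1) + (T + (.C (weight pre) +
      ((.X * (.C W * (.X + 1) + 2) + 1) + ((p * (.C (weight blank) * (.X + p + 1) + 2) + 1) +
        (.C (weight post) * (.X + p + 1) + (((.X + p) * 2 + 1) + (.X * 2 + 1)))))))) fun w => ?_
  set n := w.length with hn
  have h1 := runs_read w [] 0 0 0 0 0 []
  have h2 := hP [] w.reverse n 0 []
  have h3 := runs_emit [] w.reverse n (p.eval n) 0 pre 0 []
  have h4 := runs_loop_rev [] sym W n hW (block sym blank w) w.reverse n (p.eval n) 0 0 (word pre 0)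
    (by simp [hn]) (fun j g hj => by simp only [block, zero_add, hj, Option.elim_some])
  have h5 := runs_loop_acc (α := α) [] blank (n + p.eval n) (block sym blank w) [] n (p.eval n) 0 n
    (word pre 0) le_rfl (fun j hj => by
      rw [block, List.getElem?_eq_none (by simpa using hj), Option.elim_none])
  have h6 := runs_emit ([] : List α) [] n 0 0 post (n + p.eval n)
    (blocks (block sym blank w) (n + p.eval n) ++ word pre 0)
  have h7 := runs_clear_idx ([] : List α) [] n 0 0 0 (n + p.eval n)
    (word post (n + p.eval n) ++ (blocks (block sym blank w) (n + p.eval n) ++ word pre 0))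
  have h8 := runs_clear_cnt ([] : List α) [] n 0 0 0 0
    (word post (n + p.eval n) ++ (blocks (block sym blank w) (n + p.eval n) ++ word pre 0))
  simp only [List.append_nil, zero_add, List.length_reverse, ← hn, mul_one] at h1 h3 h4
  have h0 : blocks (block sym blank w) 0 = [] := rfl
  rw [h0, List.nil_append] at h4
  obtain ⟨t, ht, hr⟩ := h1.seq (h2.seq (h3.seq (h4.seq (h5.seq (h6.seq (h7.seq h8))))))
  refine ⟨t, by simpa [Polynomial.eval_add, Polynomial.eval_mul] using ht, ?_⟩
  convert hr using 1
  · funext k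
    cases k <;> simp [Mem.stacks]
  · funext k
    cases k <;> simp [Mem.stacks, h, hn]

end Generator

/-! ### Renaming the states and messages of a protocol -/

/-- Renaming the message of an action. -/
def Op.map {S S' : Type} (ψ : S → S') : Op S → Op S'
  | bcast a => bcast (ψ a)
  | recv a => recv (ψ a)

/-- Renaming the states and the message of a transition. -/
def Protocol.mapTrans {Q Q' S S' : Type} (φ : Q → Q') (ψ : S → S') (t : Q × Op S × Q) :
    Q' × Op S' × Q' :=
  (φ t.1, t.2.1.map ψ, φ t.2.2)

namespace Protocol

variable {Q Q' S S' : Type}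

/-- `P'` arises from `P` by renaming states and messages by `φ` and `ψ`, which are injective on the
states of `D` and the messages of `E`; no others occur in `P`. -/
structure IsRenaming (P : Protocol Q S) (P' : Protocol Q' S') (φ : Q → Q') (ψ : S → S')
    (D : Set Q) (E : Set S) : Prop where
  injOn_state : Set.InjOn φ D
  injOn_msg : Set.InjOn ψ E
  init_mem : P.init ∈ D
  init_eq : P'.init = φ P.init
  bcast_mem : ∀ q a p, (q, Op.bcast a, p) ∈ P.trans → q ∈ D ∧ a ∈ E ∧ p ∈ D
  recv_mem : ∀ q a p, (q, Op.recv a, p) ∈ P.trans → q ∈ D ∧ a ∈ E ∧ p ∈ D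
  trans_iff : ∀ t', t' ∈ P'.trans ↔ ∃ t ∈ P.trans, mapTrans φ ψ t = t'

namespace IsRenaming

variable {P : Protocol Q S} {P' : Protocol Q' S'} {φ : Q → Q'} {ψ : S → S'} {D : Set Q} {E : Set S}

theorem exists_of_bcast (h : IsRenaming P P' φ ψ D E) {q' : Q'} {a' : S'} {p' : Q'}
    (ht : (q', Op.bcast a', p') ∈ P'.trans) :
    ∃ q a p, (q, Op.bcast a, p) ∈ P.trans ∧ φ q = q' ∧ ψ a = a' ∧ φ p = p' := by
  obtain ⟨⟨q, o, p⟩, ht, he⟩ := (h.trans_iff _).1 ht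
  cases o with
  | bcast a =>
    simp only [mapTrans, Op.map, Prod.mk.injEq, Op.bcast.injEq] at he
    exact ⟨q, a, p, ht, he⟩
  | recv a => simp [mapTrans, Op.map] at he

theorem exists_of_recv (h : IsRenaming P P' φ ψ D E) {q' : Q'} {a' : S'} {p' : Q'}
    (ht : (q', Op.recv a', p') ∈ P'.trans) :
    ∃ q a p, (q, Op.recv a, p) ∈ P.trans ∧ φ q = q' ∧ ψ a = a' ∧ φ p = p' := by
  obtain ⟨⟨q, o, p⟩, ht, he⟩ := (h.trans_iff _).1 ht
  cases o with
  | bcast a => simp [mapTrans, Op.map] at he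
  | recv a =>
    simp only [mapTrans, Op.map, Prod.mk.injEq, Op.recv.injEq] at he
    exact ⟨q, a, p, ht, he⟩

theorem waitOnly (h : IsRenaming P P' φ ψ D E) (hP : P.WaitOnly) : P'.WaitOnly := by
  intro q'
  by_contra hq
  push Not at hq
  obtain ⟨⟨a₁, p₁, h₁⟩, a₂, p₂, h₂⟩ := hq
  obtain ⟨q₁, b₁, r₁, t₁, rfl, -, -⟩ := h.exists_of_recv h₁
  obtain ⟨q₂, b₂, r₂, t₂, hq, -, -⟩ := h.exists_of_bcast h₂
  obtain rfl := h.injOn_state (h.bcast_mem _ _ _ t₂).1 (h.recv_mem _ _ _ t₁).1 hq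
  rcases hP q₂ with h' | h'
  · exact h' _ _ t₁
  · exact h' _ _ t₂

theorem isAction_init (h : IsRenaming P P' φ ψ D E) (hP : P.IsAction P.init) :
    P'.IsAction P'.init := by
  rintro ⟨a', p', ht⟩
  rw [h.init_eq] at ht
  obtain ⟨q, a, p, t, hq, -, -⟩ := h.exists_of_recv ht
  obtain rfl := h.injOn_state (h.recv_mem _ _ _ t).1 h.init_mem hq
  exact hP ⟨a, p, t⟩

theorem noBroadcastSelfLoop (h : IsRenaming P P' φ ψ D E) (hP : P.NoBroadcastSelfLoop) :
    P'.NoBroadcastSelfLoop := by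
  intro q' a' ht
  obtain ⟨q, a, p, t, hq, -, hp⟩ := h.exists_of_bcast ht
  obtain rfl := h.injOn_state (h.bcast_mem _ _ _ t).1 (h.bcast_mem _ _ _ t).2.2 (hq.trans hp.symm)
  exact hP _ _ t

theorem bcast_iff (h : IsRenaming P P' φ ψ D E) {q p : Q} {a : S} (hq : q ∈ D) (ha : a ∈ E)
    (hp : p ∈ D) : (φ q, Op.bcast (ψ a), φ p) ∈ P'.trans ↔ (q, Op.bcast a, p) ∈ P.trans := by
  refine ⟨fun ht => ?_, fun ht => (h.trans_iff _).2 ⟨_, ht, rfl⟩⟩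
  obtain ⟨q₁, a₁, p₁, t, e₁, e₂, e₃⟩ := h.exists_of_bcast ht
  obtain ⟨m₁, m₂, m₃⟩ := h.bcast_mem _ _ _ t
  rwa [h.injOn_state m₁ hq e₁, h.injOn_msg m₂ ha e₂, h.injOn_state m₃ hp e₃] at t

theorem recv_iff (h : IsRenaming P P' φ ψ D E) {q p : Q} {a : S} (hq : q ∈ D) (ha : a ∈ E)
    (hp : p ∈ D) : (φ q, Op.recv (ψ a), φ p) ∈ P'.trans ↔ (q, Op.recv a, p) ∈ P.trans := by
  refine ⟨fun ht => ?_, fun ht => (h.trans_iff _).2 ⟨_, ht, rfl⟩⟩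
  obtain ⟨q₁, a₁, p₁, t, e₁, e₂, e₃⟩ := h.exists_of_recv ht
  obtain ⟨m₁, m₂, m₃⟩ := h.recv_mem _ _ _ t
  rwa [h.injOn_state m₁ hq e₁, h.injOn_msg m₂ ha e₂, h.injOn_state m₃ hp e₃] at t

theorem mem_R_iff (h : IsRenaming P P' φ ψ D E) {q : Q} {a : S} (hq : q ∈ D) (ha : a ∈ E) :
    ψ a ∈ P'.R (φ q) ↔ a ∈ P.R q := by
  constructor
  · rintro ⟨p', ht⟩
    obtain ⟨q₁, a₁, p₁, t, e₁, e₂, -⟩ := h.exists_of_recv ht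
    obtain ⟨m₁, m₂, -⟩ := h.recv_mem _ _ _ t
    rw [h.injOn_state m₁ hq e₁, h.injOn_msg m₂ ha e₂] at t
    exact ⟨p₁, t⟩
  · rintro ⟨p, ht⟩
    exact ⟨φ p, (h.trans_iff _).2 ⟨_, ht, rfl⟩⟩

theorem stepBy_iff (h : IsRenaming P P' φ ψ D E) {n : ℕ} {e : Fin n} {q p : Q} {a : S}
    (hq : q ∈ D) (ha : a ∈ E) (hp : p ∈ D) {C C' : Fin n → Q} (hC : ∀ i, C i ∈ D)
    (hC' : ∀ i, C' i ∈ D) :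
    P'.StepBy e (φ q) (ψ a) (φ p) (φ ∘ C) (φ ∘ C') ↔ P.StepBy e q a p C C' := by
  simp only [StepBy, Function.comp_apply, h.bcast_iff hq ha hp, h.injOn_state.eq_iff (hC _) hq,
    h.injOn_state.eq_iff (hC' _) hp, h.recv_iff (hC _) ha (hC' _), h.mem_R_iff (hC _) ha,
    h.injOn_state.eq_iff (hC' _) (hC _)]

theorem mem_of_stepBy (h : IsRenaming P P' φ ψ D E) {n : ℕ} {e : Fin n} {q p : Q} {a : S}
    {C C' : Fin n → Q} (hC : ∀ i, C i ∈ D) (hs : P.StepBy e q a p C C') : ∀ i, C' i ∈ D := by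
  obtain ⟨ht, -, he, hr⟩ := hs
  intro i
  by_cases hi : i = e
  · rw [hi, he]
    exact (h.bcast_mem _ _ _ ht).2.2
  · rcases hr i hi with hr | ⟨-, hr⟩
    · exact (h.recv_mem _ _ _ hr).2.2
    · rw [hr]
      exact hC i

theorem repeatedlyCoverable_iff (h : IsRenaming P P' φ ψ D E) {q p : Q} {a : S} (hq : q ∈ D)
    (ha : a ∈ E) (hp : p ∈ D) :
    P'.RepeatedlyCoverable (φ q) (ψ a) (φ p) ↔ P.RepeatedlyCoverable q a p := by
  constructor
  · rintro ⟨n, hn, ρ', ⟨h0, hρ'⟩, e, hinf⟩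
    have step : ∀ i (C : Fin n → Q), (∀ k, C k ∈ D) → ρ' i = φ ∘ C →
        ∃ C₁ : Fin n → Q, (∀ k, C₁ k ∈ D) ∧ ρ' (i + 1) = φ ∘ C₁ ∧ P.Step C C₁ := by
      intro i C hC hi
      obtain ⟨e₀, q', a', p', hs⟩ := hρ' i
      rw [hi] at hs
      obtain ⟨q₀, a₀, p₀, t, rfl, rfl, rfl⟩ := h.exists_of_bcast hs.1
      obtain ⟨m₁, m₂, m₃⟩ := h.bcast_mem _ _ _ t
      obtain ⟨hs₁, hs₂, hs₃, hs₄⟩ := hs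
      have : ∀ k, ∃ x ∈ D, φ x = ρ' (i + 1) k := by
        intro k
        by_cases hk : k = e₀
        · exact ⟨p₀, m₃, by rw [hk, hs₃]⟩
        · rcases hs₄ k hk with hr | ⟨-, hr⟩
          · obtain ⟨_, _, p₁, t₁, -, -, hp₁⟩ := h.exists_of_recv hr
            exact ⟨p₁, (h.recv_mem _ _ _ t₁).2.2, hp₁⟩
          · exact ⟨C k, hC k, hr.symm⟩
      choose C₁ hC₁ hC₁' using this
      have hC₁'' : ρ' (i + 1) = φ ∘ C₁ := funext fun k => (hC₁' k).symm
      refine ⟨C₁, hC₁, hC₁'', e₀, q₀, a₀, p₀, ?_⟩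
      rw [hC₁''] at hs₃ hs₄
      exact (h.stepBy_iff m₁ m₂ m₃ hC hC₁).1 ⟨hs₁, hs₂, hs₃, hs₄⟩
    choose! next hnext₁ hnext₂ hnext₃ using step
    let ρ : ℕ → Fin n → Q := fun i => Nat.rec (fun _ => P.init) next i
    have hρ : ∀ i, (∀ k, ρ i k ∈ D) ∧ ρ' i = φ ∘ ρ i := by
      intro i
      induction i with
      | zero => exact ⟨fun _ => h.init_mem, funext fun k => (h0 k).trans h.init_eq⟩
      | succ i ih => exact ⟨hnext₁ i _ ih.1 ih.2, hnext₂ i _ ih.1 ih.2⟩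
    refine ⟨n, hn, ρ, ⟨fun _ => rfl, fun i => hnext₃ i _ (hρ i).1 (hρ i).2⟩, e, fun i => ?_⟩
    obtain ⟨j, hj, hs⟩ := hinf i
    rw [(hρ j).2, (hρ (j + 1)).2] at hs
    exact ⟨j, hj, (h.stepBy_iff hq ha hp (hρ j).1 (hρ (j + 1)).1).1 hs⟩
  · rintro ⟨n, hn, ρ, ⟨h0, hρ⟩, e, hinf⟩
    have hD : ∀ i k, ρ i k ∈ D := by
      intro i
      induction i with
      | zero => intro k; rw [h0]; exact h.init_mem
      | succ i ih =>
        obtain ⟨_, _, _, _, hs⟩ := hρ i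
        exact h.mem_of_stepBy ih hs
    refine ⟨n, hn, fun i => φ ∘ ρ i, ⟨fun k => ?_, fun i => ?_⟩, e, fun i => ?_⟩
    · rw [h.init_eq, ← h0 k]
      rfl
    · obtain ⟨e₀, q₀, a₀, p₀, hs⟩ := hρ i
      obtain ⟨m₁, m₂, m₃⟩ := h.bcast_mem _ _ _ hs.1
      exact ⟨_, _, _, _, (h.stepBy_iff m₁ m₂ m₃ (hD i) (hD (i + 1))).2 hs⟩
    · obtain ⟨j, hj, hs⟩ := hinf i
      exact ⟨j, hj, (h.stepBy_iff hq ha hp (hD j) (hD (j + 1))).2 hs⟩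

end IsRenaming

end Protocol

/-! ### The instance presenting the protocol of a stack machine -/

namespace StackMachine

open RuleSystem Generator

variable {K C G : Type}

/-- The states of the protocol simulating a stack machine. -/
abbrev PState (K C G : Type) : Type :=
  St (Val K C G)

/-- The messages of the protocol simulating a stack machine. -/
abbrev PMsg (C G : Type) : Type :=
  Msg (ℕ × C × Option G)

/-- The transitions of the protocol simulating a stack machine. -/
abbrev PTrans (K C G : Type) : Type :=
  PState K C G × Op (PMsg C G) × PState K C G

/-! #### Numbering states and messages -/

section Numbering

variable {nX nY : ℕ} (iX : Val K C G ≃ Fin nX) (iY : C × Option G ≃ Fin nY)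

/-- The number of a state: there are `nX + 3` states for each cell. -/
def stateCode : PState K C G → ℕ
  | .init => 0
  | .sink => 1
  | .lead => 2
  | .relay => 3
  | .wait j => (nX + 3) * j + 4
  | .ready j => (nX + 3) * j + 5
  | .idle j => (nX + 3) * j + 6
  | .cell j x => (nX + 3) * j + ((iX x).1 + 7)

/-- The number of a message: there are `nY + 1` messages for each cell. -/
def msgCode : PMsg C G → ℕ
  | .tau => 0
  | .go => 1
  | .finish => 2
  | .ack j => (nY + 1) * j + 3
  | .letter a => (nY + 1) * a.1 + ((iY a.2).1 + 4)

theorem mul_add_inj {m j j' r r' : ℕ} (hr : r < m) (hr' : r' < m) (h : m * j + r = m * j' + r') :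
    j = j' ∧ r = r' := by
  have h1 : (m * j + r) / m = (m * j' + r') / m := by rw [h]
  have h2 : (m * j + r) % m = (m * j' + r') % m := by rw [h]
  have hm : 0 < m := by omega
  simp only [Nat.mul_add_div hm, Nat.div_eq_of_lt hr, Nat.div_eq_of_lt hr', add_zero] at h1
  simp only [Nat.mul_add_mod, Nat.mod_eq_of_lt hr, Nat.mod_eq_of_lt hr'] at h2
  exact ⟨h1, h2⟩

theorem stateCode_injective : Function.Injective (stateCode iX) := by
  -- the number of a state is below 4, or `(nX + 3) * j + r + 4` with `r < nX + 3`
  have key : ∀ s : PState K C G, (stateCode iX s < 4 ∧ (s = .init ∨ s = .sink ∨ s = .lead ∨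
      s = .relay)) ∨ ∃ j, ∃ r < nX + 3, stateCode iX s = (nX + 3) * j + r + 4 ∧
        (r = 0 ∧ s = .wait j ∨ r = 1 ∧ s = .ready j ∨ r = 2 ∧ s = .idle j ∨
          ∃ x, r = (iX x).1 + 3 ∧ s = .cell j x) := by
    intro s
    cases s with
    | init => simp [stateCode]
    | sink => simp [stateCode]
    | lead => simp [stateCode]
    | relay => simp [stateCode]
    | wait j => exact .inr ⟨j, 0, by omega, rfl, .inl ⟨rfl, rfl⟩⟩
    | ready j => exact .inr ⟨j, 1, by omega, rfl, .inr (.inl ⟨rfl, rfl⟩)⟩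
    | idle j => exact .inr ⟨j, 2, by omega, rfl, .inr (.inr (.inl ⟨rfl, rfl⟩))⟩
    | cell j x =>
      exact .inr ⟨j, (iX x).1 + 3, by omega, by simp only [stateCode]; omega,
        .inr (.inr (.inr ⟨x, rfl, rfl⟩))⟩
  intro s s' h
  rcases key s with ⟨h1, h2⟩ | ⟨j, r, hr, h1, h2⟩ <;>
    rcases key s' with ⟨h1', h2'⟩ | ⟨j', r', hr', h1', h2'⟩
  · rcases h2 with rfl | rfl | rfl | rfl <;> rcases h2' with rfl | rfl | rfl | rfl <;>
      simp_all [stateCode]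
  · omega
  · omega
  · obtain ⟨rfl, rfl⟩ := mul_add_inj hr hr' (show (nX + 3) * j + r = (nX + 3) * j' + r' by omega)
    rcases h2 with ⟨e, rfl⟩ | ⟨e, rfl⟩ | ⟨e, rfl⟩ | ⟨x, e, rfl⟩ <;>
      rcases h2' with ⟨e', rfl⟩ | ⟨e', rfl⟩ | ⟨e', rfl⟩ | ⟨x', e', rfl⟩ <;> first | rfl | omega | skip
    rw [iX.injective (Fin.ext (show (iX x).1 = (iX x').1 by omega))]

theorem msgCode_injective : Function.Injective (msgCode iY) := by
  -- the number of a message is below 3, or `(nY + 1) * j + r + 3` with `r < nY + 1`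
  have key : ∀ s : PMsg C G, (msgCode iY s < 3 ∧ (s = .tau ∨ s = .go ∨ s = .finish)) ∨
      ∃ j, ∃ r < nY + 1, msgCode iY s = (nY + 1) * j + r + 3 ∧
        (r = 0 ∧ s = .ack j ∨ ∃ y, r = (iY y).1 + 1 ∧ s = .letter (j, y)) := by
    intro s
    cases s with
    | tau => simp [msgCode]
    | go => simp [msgCode]
    | finish => simp [msgCode]
    | ack j => exact .inr ⟨j, 0, by omega, rfl, .inl ⟨rfl, rfl⟩⟩
    | letter a =>
      exact .inr ⟨a.1, (iY a.2).1 + 1, by omega, by simp only [msgCode]; omega,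
        .inr ⟨a.2, rfl, rfl⟩⟩
  intro s s' h
  rcases key s with ⟨h1, h2⟩ | ⟨j, r, hr, h1, h2⟩ <;>
    rcases key s' with ⟨h1', h2'⟩ | ⟨j', r', hr', h1', h2'⟩
  · rcases h2 with rfl | rfl | rfl <;> rcases h2' with rfl | rfl | rfl <;>
      simp_all [msgCode]
  · omega
  · omega
  · obtain ⟨rfl, rfl⟩ := mul_add_inj hr hr' (show (nY + 1) * j + r = (nY + 1) * j' + r' by omega)
    rcases h2 with ⟨e, rfl⟩ | ⟨y, e, rfl⟩ <;> rcases h2' with ⟨e', rfl⟩ | ⟨y', e', rfl⟩ <;>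
      first | rfl | omega | skip
    rw [iY.injective (Fin.ext (show (iY y).1 = (iY y').1 by omega))]

/-! #### Translating transitions to other cells -/

/-- The state with all the indices of cells translated by `h`, except for those of the states of the
control cell `0`. -/
def shiftState (h : ℕ) : PState K C G → PState K C G
  | .wait j => .wait (j + h)
  | .ready j => .ready (j + h)
  | .idle j => .idle (j + h)
  | .cell (j + 1) x => .cell (j + h + 1) x
  | s => s

/-- The message with all the indices translated by `h`. -/
def shiftMsg (h : ℕ) : PMsg C G → PMsg C G
  | .ack j => .ack (j + h)
  | .letter a => .letter (a.1 + h, a.2)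
  | m => m

/-- The transition translated by `h`. -/
def shift (h : ℕ) : PTrans K C G → PTrans K C G :=
  Protocol.mapTrans (shiftState h) (shiftMsg h)

/-- The number of the translated state, as an affine function of the translation. -/
def stateItem (s : PState K C G) : Item :=
  .num (match s with
    | .wait _ => nX + 3
    | .ready _ => nX + 3
    | .idle _ => nX + 3
    | .cell (_ + 1) _ => nX + 3
    | _ => 0) (stateCode iX s)

/-- The number of the translated message, as an affine function of the translation. -/
def msgItem (m : PMsg C G) : Item :=
  .num (match m with
    | .ack _ => nY + 1
    | .letter _ => nY + 1
    | _ => 0) (msgCode iY m)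

theorem eval_stateItem (h : ℕ) (s : PState K C G) :
    (stateItem iX s).eval h = RCInstance.encodeNat (stateCode iX (shiftState h s)) := by
  have key : ∀ n n', n = n' → RCInstance.encodeNat n = RCInstance.encodeNat n' := by
    rintro n _ rfl
    rfl
  cases s with
  | cell j x => cases j <;> refine key _ _ ?_ <;> simp [stateCode, shiftState]; ring
  | _ => refine key _ _ ?_; simp [stateCode, shiftState] <;> ring

theorem eval_msgItem (h : ℕ) (m : PMsg C G) :
    (msgItem iY m).eval h = RCInstance.encodeNat (msgCode iY (shiftMsg h m)) := by
  have key : ∀ n n', n = n' → RCInstance.encodeNat n = RCInstance.encodeNat n' := by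
    rintro n _ rfl
    rfl
  cases m <;> refine key _ _ ?_ <;> simp [msgCode, shiftMsg] <;> ring

/-- The word for a transition with numbered states and messages. -/
def transWord : PTrans K C G → List RCInstance.Sym
  | (q, .bcast a, p) => RCInstance.encodeNat (stateCode iX q) ++ .bang ::
      (RCInstance.encodeNat (msgCode iY a) ++ RCInstance.encodeNat (stateCode iX p))
  | (q, .recv a, p) => RCInstance.encodeNat (stateCode iX q) ++ .quest ::
      (RCInstance.encodeNat (msgCode iY a) ++ RCInstance.encodeNat (stateCode iX p))

/-- The words for the translations of a transition. -/
def transItems : PTrans K C G → List Item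
  | (q, .bcast a, p) => [stateItem iX q, .sym .bang, msgItem iY a, stateItem iX p]
  | (q, .recv a, p) => [stateItem iX q, .sym .quest, msgItem iY a, stateItem iX p]

theorem word_transItems (h : ℕ) (t : PTrans K C G) :
    word (transItems iX iY t) h = transWord iX iY (shift h t) := by
  obtain ⟨q, o, p⟩ := t
  cases o <;>
    simp [word, transItems, transWord, shift, Protocol.mapTrans, Op.map, eval_stateItem,
      eval_msgItem, Item.eval.eq_2]

theorem word_flatMap_transItems (h : ℕ) (l : List (PTrans K C G)) :
    word (l.flatMap (transItems iX iY)) h =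
      (l.map (shift h)).flatMap (transWord iX iY) := by
  induction l with
  | nil => rfl
  | cons t l ih =>
    rw [List.flatMap_cons, List.map_cons, List.flatMap_cons, ← ih, ← word_transItems]
    simp [word]

theorem shift_zero (t : PTrans K C G) : shift 0 t = t := by
  obtain ⟨q, o, p⟩ := t
  have h1 : ∀ s : PState K C G, shiftState 0 s = s := by
    intro s
    cases s with
    | cell j x => cases j <;> rfl
    | _ => rfl
  have h2 : ∀ m : PMsg C G, shiftMsg 0 m = m := by
    intro m
    cases m <;> rfl
  cases o <;> simp [shift, Protocol.mapTrans, Op.map, h1, h2]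

end Numbering

/-! #### The list of transitions -/

variable (M : StackMachine K C G) (Vs : List (Val K C G)) (Ys : List (C × Option G))

/-- The transitions not depending on a cell. -/
def leaderTrans : List (PTrans K C G) :=
  [(.init, .bcast .tau, .wait 0), (.relay, .bcast .tau, .lead), (.lead, .bcast .finish, .wait 0)]

/-- The transitions for the cell `j` with initial value `x`, letters excepted. -/
def cellTrans (j : ℕ) (x : Val K C G) : List (PTrans K C G) :=
  [(.init, .bcast .tau, .ready j), (.ready j, .bcast (.ack j), .idle j),
    (.wait j, .recv (.ack j), .wait (j + 1)), (.wait j, .recv .go, .sink),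
    (.idle j, .recv .go, .cell j x)] ++
  Vs.map fun v => (.cell j v, .recv .finish,
    if Sum.elim M.accepts (fun _ => true) v then .ready j else .sink)

theorem shift_cellTrans (h j : ℕ) (x : Val K C G) :
    (M.cellTrans Vs (j + 1) x).map (shift h) = M.cellTrans Vs (j + 1 + h) x := by
  simp only [cellTrans, List.map_append, List.map_cons, List.map_nil, List.map_map]
  congr 1
  · simp only [shift, Protocol.mapTrans, Op.map, shiftState, shiftMsg]
    grind
  · refine List.map_congr_left fun v _ => ?_
    simp only [Function.comp_apply, shift, Protocol.mapTrans, Op.map, shiftMsg]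
    split_ifs <;> simp only [shiftState, Prod.mk.injEq, St.cell.injEq, and_true] <;> omega

variable [DecidableEq K] [DecidableEq C] [DecidableEq G]

/-- The transitions for the letters for stacks of height `0`. -/
def letterTrans : List (PTrans K C G) :=
  Ys.flatMap fun y => (.lead, .bcast (.letter (0, y)), .relay) :: Vs.flatMap fun v =>
    [(.cell 0 v, .recv (.letter (0, y)), (M.effControl y.1 y.2 v).elim .sink (.cell 0)),
      (.cell 1 v, .recv (.letter (0, y)), (M.effTop y.1 y.2 v).elim .sink (.cell 1)),
      (.cell 2 v, .recv (.letter (0, y)), (M.effBlank y.1 y.2 v).elim .sink (.cell 2))]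

/-- The transitions to be translated by all `h < B`, where `x` is the initial value of the cell
`h + 2`. -/
def blockTrans (x : Val K C G) : List (PTrans K C G) :=
  M.cellTrans Vs 2 x ++ M.letterTrans Vs Ys

/-- The transitions for the control cell and for the cell with the bottom markers. -/
def firstTrans : List (PTrans K C G) :=
  leaderTrans ++ (M.cellTrans Vs 0 (.inl M.init) ++ M.cellTrans Vs 1 (.inr fun _ => some none))

/-- The list of all the transitions, where `x h` is the initial value of the cell `h + 2`. -/
def allTrans (x : ℕ → Val K C G) (B : ℕ) : List (PTrans K C G) :=
  (.wait (B + 2), .bcast .go, .lead) ::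
    ((List.range B).reverse.flatMap (fun h => (M.blockTrans Vs Ys (x h)).map (shift h)) ++
      M.firstTrans Vs)

variable {Vs Ys}

theorem tr_of_mem_cellTrans {j : ℕ} {x : Val K C G} (S : K → List G) (B : ℕ)
    (hj : j < B + 2) (hx : (M.rules S B).start j = x) {t : PTrans K C G} :
    t ∈ M.cellTrans Vs j x → (M.rules S B).Tr t := by
  have hj' : j < (M.rules S B).size := hj
  intro ht
  simp only [cellTrans, List.cons_append, List.nil_append, List.mem_cons, List.mem_map] at ht
  rcases ht with rfl | rfl | rfl | rfl | rfl | ⟨v, -, rfl⟩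
  · exact .join j hj'
  · exact .ack j hj'
  · exact .await j hj'
  · exact .kill j hj'
  · rw [← hx]
    exact .start j hj'
  · exact .check j hj' v

theorem shift_letterTrans (h : ℕ) :
    (M.letterTrans Vs Ys).map (shift h) =
      Ys.flatMap fun y => (.lead, .bcast (.letter (h, y)), .relay) :: Vs.flatMap fun v =>
        [(.cell 0 v, .recv (.letter (h, y)), (M.effControl y.1 y.2 v).elim .sink (.cell 0)),
          (.cell (h + 1) v, .recv (.letter (h, y)),
            (M.effTop y.1 y.2 v).elim .sink (.cell (h + 1))),
          (.cell (h + 2) v, .recv (.letter (h, y)),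
            (M.effBlank y.1 y.2 v).elim .sink (.cell (h + 2)))] := by
  have key : ∀ (o : Option (Val K C G)) (j : ℕ),
      shiftState h (o.elim .sink (.cell (j + 1))) = o.elim .sink (.cell (j + h + 1)) := by
    intro o j
    cases o <;> rfl
  have key0 : ∀ o : Option (Val K C G),
      shiftState h (o.elim .sink (.cell 0)) = o.elim .sink (.cell 0) := by
    intro o
    cases o <;> rfl
  simp only [letterTrans, List.map_flatMap, List.map_cons, List.map_nil, shift,
    Protocol.mapTrans, Op.map, shiftMsg, key0, key _ 0, key _ 1, zero_add]
  simp only [shiftState, zero_add, show 1 + h + 1 = h + 2 by omega]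

theorem mem_allTrans_iff (hVs : ∀ v, v ∈ Vs) (hYs : ∀ y, y ∈ Ys) (S : K → List G) (B : ℕ)
    {t : PTrans K C G} :
    t ∈ M.allTrans Vs Ys (fun h => (M.rules S B).start (h + 2)) B ↔ (M.rules S B).Tr t := by
  have hblock : t ∈ (List.range B).reverse.flatMap (fun h =>
      (M.blockTrans Vs Ys ((M.rules S B).start (h + 2))).map (shift h)) ↔
      ∃ h < B, t ∈ M.cellTrans Vs (h + 2) ((M.rules S B).start (h + 2)) ∨
        t ∈ (M.letterTrans Vs Ys).map (shift h) := by
    simp only [List.mem_flatMap, List.mem_reverse, List.mem_range, blockTrans, List.map_append,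
      List.mem_append, shift_cellTrans, show ∀ h, 1 + 1 + h = h + 2 by omega]
  rw [allTrans, List.mem_cons, List.mem_append, hblock]
  constructor
  · rintro (rfl | ⟨h, hh, ht | ht⟩ | ht)
    · exact .go
    · exact M.tr_of_mem_cellTrans S B (by omega) rfl ht
    · rw [shift_letterTrans] at ht
      simp only [List.mem_flatMap, List.mem_cons, List.not_mem_nil, or_false] at ht
      obtain ⟨y, -, rfl | ⟨v, -, rfl | rfl | rfl⟩⟩ := ht
      · exact .letter _ hh
      · exact .read 0 (show 0 < B + 2 by omega) v _ hh _ (by simp [rules])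
      · exact .read (h + 1) (show h + 1 < B + 2 by omega) v _ hh _ (by simp [rules])
      · exact .read (h + 2) (show h + 2 < B + 2 by omega) v _ hh _ (by simp [rules])
    · simp only [firstTrans, leaderTrans, List.mem_append, List.mem_cons, List.not_mem_nil,
        or_false] at ht
      rcases ht with (rfl | rfl | rfl) | ht | ht
      · exact .joinLead
      · exact .relay
      · exact .finish
      · exact M.tr_of_mem_cellTrans S B (by omega) rfl ht
      · refine M.tr_of_mem_cellTrans S B (by omega) ?_ ht
        simp only [rules, values, Sum.inr.injEq]
        funext k
        exact content_zero _
  · have hcell : ∀ j < B + 2, t ∈ M.cellTrans Vs j ((M.rules S B).start j) →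
        t = (.wait (B + 2), .bcast .go, .lead) ∨ (∃ h < B, t ∈ M.cellTrans Vs (h + 2)
          ((M.rules S B).start (h + 2)) ∨ t ∈ (M.letterTrans Vs Ys).map (shift h)) ∨
          t ∈ M.firstTrans Vs := by
      intro j hj ht
      match j with
      | 0 => exact .inr (.inr (List.mem_append_right _ (List.mem_append_left _ ht)))
      | 1 =>
        have : (M.rules S B).start 1 = .inr fun _ => some none :=
          congrArg Sum.inr (funext fun k => content_zero _)
        rw [this] at ht
        exact .inr (.inr (List.mem_append_right _ (List.mem_append_right _ ht)))
      | h + 2 => exact .inr (.inl ⟨h, by omega, .inl ht⟩)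
    have hletter : ∀ h < B, t ∈ (M.letterTrans Vs Ys).map (shift h) →
        t = (.wait (B + 2), .bcast .go, .lead) ∨ (∃ h < B, t ∈ M.cellTrans Vs (h + 2)
          ((M.rules S B).start (h + 2)) ∨ t ∈ (M.letterTrans Vs Ys).map (shift h)) ∨
          t ∈ M.firstTrans Vs := fun h hh ht => .inr (.inl ⟨h, hh, .inr ht⟩)
    intro ht
    cases ht with
    | joinLead => exact .inr (.inr (by simp [firstTrans, leaderTrans]))
    | relay => exact .inr (.inr (by simp [firstTrans, leaderTrans]))
    | finish => exact .inr (.inr (by simp [firstTrans, leaderTrans]))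
    | go => exact .inl rfl
    | join j hj => exact hcell j hj (by simp [cellTrans])
    | ack j hj => exact hcell j hj (by simp [cellTrans])
    | await j hj => exact hcell j hj (by simp [cellTrans])
    | kill j hj => exact hcell j hj (by simp [cellTrans])
    | start j hj => exact hcell j hj (by simp [cellTrans])
    | check j hj v =>
      refine hcell j hj (List.mem_append_right _ (List.mem_map.2 ⟨v, hVs v, rfl⟩))
    | letter a ha =>
      refine hletter a.1 ha ?_
      rw [shift_letterTrans]
      exact List.mem_flatMap.2 ⟨a.2, hYs _, List.mem_cons_self⟩
    | read j hj v a ha f hf =>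
      refine hletter a.1 ha ?_
      rw [shift_letterTrans]
      refine List.mem_flatMap.2 ⟨a.2, hYs _, List.mem_cons_of_mem _
        (List.mem_flatMap.2 ⟨v, hVs v, ?_⟩)⟩
      simp only [rules] at hf
      split_ifs at hf with h1 h2 h3
      · obtain rfl := Option.some.inj hf
        subst h1
        exact List.mem_cons_self
      · obtain rfl := Option.some.inj hf
        subst h2
        exact List.mem_cons_of_mem _ List.mem_cons_self
      · obtain rfl := Option.some.inj hf
        subst h3
        exact List.mem_cons_of_mem _ (List.mem_cons_of_mem _ List.mem_cons_self)

end StackMachine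

/-! ### The reduction -/

namespace StackMachine

open RuleSystem Generator

variable {K C G : Type}

/-- The number of states used for heights below `B`. -/
def numStates (nX B : ℕ) : ℕ :=
  (nX + 3) * (B + 3) + 4

/-- The number of messages used for heights below `B`. -/
def numMsgs (nY B : ℕ) : ℕ :=
  (nY + 1) * (B + 2) + 3

section Bounds

variable {nX nY : ℕ} (iX : Val K C G ≃ Fin nX) (iY : C × Option G ≃ Fin nY) (B : ℕ)

/-- The state as an element of the state set of the instance (`0` if its number is too large). -/
def stateFin (s : PState K C G) : Fin (numStates nX B) :=
  if h : stateCode iX s < numStates nX B then ⟨_, h⟩ else ⟨0, by simp [numStates]⟩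

/-- The message as an element of the message set of the instance (`0` if its number is too
large). -/
def msgFin (m : PMsg C G) : Fin (numMsgs nY B) :=
  if h : msgCode iY m < numMsgs nY B then ⟨_, h⟩ else ⟨0, by simp [numMsgs]⟩

/-- The states with small numbers. -/
def smallStates : Set (PState K C G) :=
  {s | stateCode iX s < numStates nX B}

/-- The messages with small numbers. -/
def smallMsgs : Set (PMsg C G) :=
  {m | msgCode iY m < numMsgs nY B}

variable {iX iY B}

theorem val_stateFin {s : PState K C G} (h : s ∈ smallStates iX B) :
    (stateFin iX B s).1 = stateCode iX s := by
  have h : stateCode iX s < numStates nX B := h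
  simp [stateFin, h]

theorem val_msgFin {m : PMsg C G} (h : m ∈ smallMsgs iY B) :
    (msgFin iY B m).1 = msgCode iY m := by
  have h : msgCode iY m < numMsgs nY B := h
  simp [msgFin, h]

theorem mul_add_lt {m j J r : ℕ} (hj : j < J) (hr : r < m) : m * j + r < m * J :=
  calc m * j + r < m * (j + 1) := by rw [Nat.mul_succ]; omega
    _ ≤ m * J := Nat.mul_le_mul_left _ hj

theorem wait_mem {j : ℕ} (hj : j < B + 3) : .wait j ∈ smallStates iX B := by
  have := mul_add_lt hj (show 0 < nX + 3 by omega)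
  simp only [smallStates, Set.mem_ofPred_eq, stateCode, numStates]
  omega

theorem ready_mem {j : ℕ} (hj : j < B + 3) : .ready j ∈ smallStates iX B := by
  have := mul_add_lt hj (show 1 < nX + 3 by omega)
  simp only [smallStates, Set.mem_ofPred_eq, stateCode, numStates]
  omega

theorem idle_mem {j : ℕ} (hj : j < B + 3) : .idle j ∈ smallStates iX B := by
  have := mul_add_lt hj (show 2 < nX + 3 by omega)
  simp only [smallStates, Set.mem_ofPred_eq, stateCode, numStates]
  omega

theorem cell_mem {j : ℕ} (hj : j < B + 3) (x : Val K C G) : .cell j x ∈ smallStates iX B := by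
  have := mul_add_lt hj (show (iX x).1 + 3 < nX + 3 by omega)
  simp only [smallStates, Set.mem_ofPred_eq, stateCode, numStates]
  omega

theorem init_mem : .init ∈ smallStates iX B := by
  simp [smallStates, stateCode, numStates]

theorem sink_mem : .sink ∈ smallStates iX B := by
  simp only [smallStates, Set.mem_ofPred_eq, stateCode, numStates]
  omega

theorem lead_mem : .lead ∈ smallStates iX B := by
  simp only [smallStates, Set.mem_ofPred_eq, stateCode, numStates]
  omega

theorem relay_mem : .relay ∈ smallStates iX B := by
  simp only [smallStates, Set.mem_ofPred_eq, stateCode, numStates]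
  omega

theorem tau_mem : .tau ∈ smallMsgs iY B := by
  simp [smallMsgs, msgCode, numMsgs]

theorem go_mem : .go ∈ smallMsgs iY B := by
  simp only [smallMsgs, Set.mem_ofPred_eq, msgCode, numMsgs]
  omega

theorem finish_mem : .finish ∈ smallMsgs iY B := by
  simp only [smallMsgs, Set.mem_ofPred_eq, msgCode, numMsgs]
  omega

theorem ack_mem {j : ℕ} (hj : j < B + 2) : .ack j ∈ smallMsgs iY B := by
  have := mul_add_lt hj (show 0 < nY + 1 by omega)
  simp only [smallMsgs, Set.mem_ofPred_eq, msgCode, numMsgs]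
  omega

theorem letter_mem {a : ℕ × C × Option G} (ha : a.1 < B + 2) : .letter a ∈ smallMsgs iY B := by
  have := mul_add_lt ha (show (iY a.2).1 + 1 < nY + 1 by omega)
  simp only [smallMsgs, Set.mem_ofPred_eq, msgCode, numMsgs]
  omega

variable [DecidableEq K] [DecidableEq C] [DecidableEq G] {M : StackMachine K C G} {S : K → List G}

theorem small_of_tr_bcast {q p : PState K C G} {a : PMsg C G}
    (h : (M.rules S B).Tr (q, .bcast a, p)) :
    q ∈ smallStates iX B ∧ a ∈ smallMsgs iY B ∧ p ∈ smallStates iX B := by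
  cases h with
  | joinLead => exact ⟨init_mem, tau_mem, wait_mem (by omega)⟩
  | join j hj => exact ⟨init_mem, tau_mem, ready_mem (Nat.lt_succ_of_lt hj)⟩
  | ack j hj =>
    exact ⟨ready_mem (Nat.lt_succ_of_lt hj), ack_mem hj, idle_mem (Nat.lt_succ_of_lt hj)⟩
  | go => exact ⟨wait_mem (Nat.lt_succ_self _), go_mem, lead_mem⟩
  | letter b hb =>
    exact ⟨lead_mem, letter_mem (Nat.lt_add_right 2 hb), relay_mem⟩
  | relay => exact ⟨relay_mem, tau_mem, lead_mem⟩
  | finish => exact ⟨lead_mem, finish_mem, wait_mem (by omega)⟩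

theorem small_of_tr_recv {q p : PState K C G} {a : PMsg C G}
    (h : (M.rules S B).Tr (q, .recv a, p)) :
    q ∈ smallStates iX B ∧ a ∈ smallMsgs iY B ∧ p ∈ smallStates iX B := by
  cases h with
  | await j hj => exact ⟨wait_mem (Nat.lt_succ_of_lt hj), ack_mem hj, wait_mem (Nat.succ_lt_succ hj)⟩
  | kill j hj => exact ⟨wait_mem (Nat.lt_succ_of_lt hj), go_mem, sink_mem⟩
  | start j hj =>
    exact ⟨idle_mem (Nat.lt_succ_of_lt hj), go_mem, cell_mem (Nat.lt_succ_of_lt hj) _⟩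
  | check j hj v =>
    refine ⟨cell_mem (Nat.lt_succ_of_lt hj) _, finish_mem, ?_⟩
    split_ifs
    · exact ready_mem (Nat.lt_succ_of_lt hj)
    · exact sink_mem
  | read j hj v b hb f hf =>
    refine ⟨cell_mem (Nat.lt_succ_of_lt hj) _, letter_mem (Nat.lt_add_right 2 hb), ?_⟩
    cases f v with
    | none => exact sink_mem
    | some x => exact cell_mem (Nat.lt_succ_of_lt hj) _

theorem encodeTrans_mapTrans {t : PTrans K C G} (h : (M.rules S B).Tr t) :
    RCInstance.encodeTrans (Protocol.mapTrans (stateFin iX B) (msgFin iY B) t) =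
      transWord iX iY t := by
  obtain ⟨q, o, p⟩ := t
  cases o with
  | bcast a =>
    obtain ⟨h1, h2, h3⟩ := small_of_tr_bcast (iX := iX) (iY := iY) h
    simp only [Protocol.mapTrans, Op.map, RCInstance.encodeTrans, transWord, val_stateFin h1,
      val_msgFin h2, val_stateFin h3]
  | recv a =>
    obtain ⟨h1, h2, h3⟩ := small_of_tr_recv (iX := iX) (iY := iY) h
    simp only [Protocol.mapTrans, Op.map, RCInstance.encodeTrans, transWord, val_stateFin h1,
      val_msgFin h2, val_stateFin h3]

end Bounds

variable [DecidableEq K] [DecidableEq C] [DecidableEq G] (M : StackMachine K C G)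
  {nX nY : ℕ} (iX : Val K C G ≃ Fin nX) (iY : C × Option G ≃ Fin nY)

/-- All the transitions, for the stacks `S` and heights below `B`. -/
def transList (S : K → List G) (B : ℕ) : List (PTrans K C G) :=
  M.allTrans (List.ofFn iX.symm) (List.ofFn iY.symm) (fun h => (M.rules S B).start (h + 2)) B

theorem mem_transList_iff (S : K → List G) (B : ℕ) {t : PTrans K C G} :
    t ∈ M.transList iX iY S B ↔ (M.rules S B).Tr t :=
  M.mem_allTrans_iff (fun v => List.mem_ofFn.2 ⟨iX v, iX.symm_apply_apply v⟩)
    (fun y => List.mem_ofFn.2 ⟨iY y, iY.symm_apply_apply y⟩) S B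

/-- The instance of Repeated Coverability for the stacks `S` and heights below `B`. -/
def rcInstance (S : K → List G) (B : ℕ) : RCInstance where
  numStates := numStates nX B
  numMsgs := numMsgs nY B
  init := stateFin iX B .init
  trans := (M.transList iX iY S B).map (Protocol.mapTrans (stateFin iX B) (msgFin iY B))
  src := stateFin iX B .lead
  msg := msgFin iY B .finish
  dst := stateFin iX B (.wait 0)
  mem_trans := List.mem_map.2 ⟨_, (M.mem_transList_iff iX iY S B).2 .finish, rfl⟩

theorem isRenaming_rcInstance (S : K → List G) (B : ℕ) :
    (M.rules S B).protocol.IsRenaming (M.rcInstance iX iY S B).protocol (stateFin iX B)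
      (msgFin iY B) (smallStates iX B) (smallMsgs iY B) where
  injOn_state s hs s' hs' h := stateCode_injective iX (by
    rw [← val_stateFin hs, ← val_stateFin hs', h])
  injOn_msg m hm m' hm' h := msgCode_injective iY (by
    rw [← val_msgFin hm, ← val_msgFin hm', h])
  init_mem := init_mem
  init_eq := rfl
  bcast_mem _ _ _ h := small_of_tr_bcast h
  recv_mem _ _ _ h := small_of_tr_recv h
  trans_iff t' := by
    refine List.mem_map.trans (exists_congr fun t => and_congr_left fun _ => ?_)
    exact M.mem_transList_iff iX iY S B

/-- The beginning of the presentation of an instance, depending on the bound for the heights. -/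
def headItems : List Item :=
  [.num (nX + 3) ((nX + 3) * 3 + 4), .num (nY + 1) ((nY + 1) * 2 + 3), .num 0 0, .num 0 2,
    .num 0 2, .num 0 4] ++ transItems iX iY (.wait 2, .bcast .go, .lead)

theorem encode_rcInstance (S : K → List G) (B : ℕ) :
    (M.rcInstance iX iY S B).encode =
      word (headItems iX iY) B ++
      (blocks (fun h => (M.blockTrans (List.ofFn iX.symm) (List.ofFn iY.symm)
          ((M.rules S B).start (h + 2))).flatMap (transItems iX iY)) B ++
        word ((M.firstTrans (List.ofFn iX.symm)).flatMap (transItems iX iY)) 0) := by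
  have h1 : (M.rcInstance iX iY S B).trans.flatMap RCInstance.encodeTrans =
      (M.transList iX iY S B).flatMap (transWord iX iY) := by
    refine (List.flatMap_map ..).trans (List.flatMap_congr fun t ht => ?_)
    exact encodeTrans_mapTrans ((M.mem_transList_iff iX iY S B).1 ht)
  have h2 : (M.transList iX iY S B).flatMap (transWord iX iY) =
      word (transItems iX iY (.wait 2, .bcast .go, .lead)) B ++
      (blocks (fun h => (M.blockTrans (List.ofFn iX.symm) (List.ofFn iY.symm)
          ((M.rules S B).start (h + 2))).flatMap (transItems iX iY)) B ++
        word ((M.firstTrans (List.ofFn iX.symm)).flatMap (transItems iX iY)) 0) := by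
    have h3 : shift B (.wait 2, .bcast .go, .lead) =
        ((.wait (B + 2), .bcast .go, .lead) : PTrans K C G) := by
      simp [shift, Protocol.mapTrans, shiftState, Op.map, shiftMsg, add_comm]
    rw [transList, allTrans, List.flatMap_cons, List.flatMap_append, word_transItems, h3,
      List.flatMap_assoc, word_flatMap_transItems]
    simp only [blocks, word_flatMap_transItems]
    congr 3
    rw [show (shift 0 : PTrans K C G → _) = id from funext shift_zero, List.map_id]
  have h4 : (stateFin iX B .init).1 = 0 := val_stateFin init_mem
  have h5 : (stateFin iX B .lead).1 = 2 := val_stateFin lead_mem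
  have h6 : (msgFin iY B .finish).1 = 2 := val_msgFin finish_mem
  have h7 : (stateFin iX B (.wait 0)).1 = 4 := val_stateFin (wait_mem (by omega))
  rw [RCInstance.encode, h1, h2]
  simp only [rcInstance, h4, h5, h6, h7, headItems, word, List.flatMap_append, List.flatMap_cons, Item.eval,
    List.append_assoc, zero_mul, zero_add, List.flatMap_nil, List.nil_append]
  simp only [numStates, numMsgs, show (nX + 3) * (B + 3) + 4 = (nX + 3) * B + ((nX + 3) * 3 + 4) by
    ring, show (nY + 1) * (B + 2) + 3 = (nY + 1) * B + ((nY + 1) * 2 + 3) by ring]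

/-- The instance as an input of Repeated Coverability for Wait-Only protocols. -/
def waitOnlyInstance (S : K → List G) (B : ℕ) : WaitOnlyInstance :=
  ⟨M.rcInstance iX iY S B, (M.isRenaming_rcInstance iX iY S B).waitOnly (waitOnly_protocol _),
    (M.isRenaming_rcInstance iX iY S B).isAction_init (isAction_init_protocol _),
    (M.isRenaming_rcInstance iX iY S B).noBroadcastSelfLoop (noBroadcastSelfLoop_protocol _)⟩

theorem repeatedCoverability_waitOnlyInstance (S : K → List G) (B : ℕ) :
    (M.waitOnlyInstance iX iY S B).RepeatedCoverability ↔
      ∃ s, Relation.ReflTransGen (M.BStep B) (M.init, S) s ∧ M.accepts s.1 := by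
  rw [← M.accepting_rules_iff S B, ← repeatedlyCoverable_protocol_iff]
  exact (M.isRenaming_rcInstance iX iY S B).repeatedlyCoverable_iff lead_mem finish_mem
    (wait_mem (j := 0) (Nat.succ_pos _))

/-- The reduction for a machine whose input is written on the stack `k₀` can be computed in
polynomial time. -/
theorem nonempty_computableInPolyTime_waitOnlyInstance {α : Type} [Finite α] (k₀ : K) (ι : α → G)
    (p : Polynomial ℕ) :
    Nonempty (Turing.TM2ComputableInPolyTime (id : List α → List α)
      WaitOnlyInstance.encoding.encode fun w =>
        M.waitOnlyInstance iX iY (fun k => if k = k₀ then w.map ι else [])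
          (w.length + p.eval w.length)) := by
  let cellVal : Option α → Val K C G := fun o => .inr fun k =>
    if k = k₀ then o.map fun g => some (ι g) else none
  let items : Option α → List Item := fun o =>
    (M.blockTrans (List.ofFn iX.symm) (List.ofFn iY.symm) (cellVal o)).flatMap (transItems iX iY)
  refine Generator.nonempty_computableInPolyTime _ _ p (fun g => items (some g)) (items none)
    ((M.firstTrans (List.ofFn iX.symm)).flatMap (transItems iX iY)) (headItems iX iY)
    fun w => (M.encode_rcInstance iX iY _ _).trans ?_
  congr 3
  funext h
  have h1 : (M.rules (fun k => if k = k₀ then w.map ι else [])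
      (w.length + p.eval w.length)).start (h + 2) = cellVal w.reverse[h]? := by
    refine congrArg Sum.inr (funext fun k => ?_)
    by_cases hk : k = k₀
    · simp [hk, content_succ, ← List.map_reverse, Function.comp_def]
    · simp [hk, content_succ]
  rw [h1, block]
  cases w.reverse[h]? <;> rfl

end StackMachine

open TM2Sim in
theorem mainTheorem5 :
    PSpaceHard WaitOnlyInstance.encoding WaitOnlyInstance.RepeatedCoverability := by
  classical
  rintro α _ L ⟨M, s, hs⟩
  obtain ⟨D, hD⟩ := exists_size_le M.tm
  obtain ⟨nX, ⟨iX⟩⟩ := Finite.exists_equiv_fin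
    (StackMachine.Val M.tm.K (Ctl M.tm) (Symb M.tm))
  obtain ⟨nY, ⟨iY⟩⟩ := Finite.exists_equiv_fin (Ctl M.tm × Option (Symb M.tm))
  -- The summand `D + 1` leaves room for the symbols pushed within a step of the Turing machine.
  refine ⟨_, (TM2Sim.machine M.tm M.outputAlphabet).nonempty_computableInPolyTime_waitOnlyInstance
    iX iY M.tm.k₀ (fun g => .inr (M.inputAlphabet.symm g)) (s + Polynomial.C (D + 1)), fun w => ?_⟩
  rw [StackMachine.repeatedCoverability_waitOnlyInstance]
  have hin : (fun k => if k = M.tm.k₀ then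
      w.map (fun g => (.inr (M.inputAlphabet.symm g) : Symb M.tm)) else []) =
      inputStacks (w.map M.inputAlphabet.invFun) := by
    funext k
    simp only [inputStacks]
    split_ifs
    · exact (List.map_map ..).symm
    · rfl
  have key := reach_accepts_iff M.outputAlphabet (l := w.map M.inputAlphabet.invFun)
    (s := s.eval w.length) (B := w.length + (s + Polynomial.C (D + 1)).eval w.length)
    (b := decide (w ∈ L)) hD
    (by simp only [Polynomial.eval_add, Polynomial.eval_C]; omega)
    (fun c hc k => (Finset.single_le_sum (f := fun k => (Turing.TM2.Cfg.stk c k).length)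
      (fun _ _ => Nat.zero_le _) (Finset.mem_univ k)).trans (hs w c hc))
    (M.outputsFun w)
  rw [← hin] at key
  exact Iff.trans (by simp) key.symm
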